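/- **Machines.** A general machine $M=(\Sigma,f)$ has a finite set $\Sigma$ of configurations, each a tuple $(w,m,o)$ of work, metadata and output registers, and a transition function $f:\Sigma\to\mathcal P(\Sigma)$. It is reversible if every configuration has at most one successor and at most one predecessor, and $C$ is terminal if $f(C)=\emptyset$. A physical embedding of $M$ is the continuous-time Markov process on $\Sigma$ that can jump between distinct $U,V$ whenever $V\in f(U)$ or $U\in f(V)$, at the Metropolis rate ($k\,e^{-(G_V-G_U)/kT}$ if $G_U<G_V$, and $k$ otherwise, for free energies $G$, a rate constant $k>0$ and a thermal energy $kT>0$). It is adiabatic if all free energies are equal, so that every jump has rate $k$. **Samplers.** Let the metadata take values in $\{-1,0,1\}$. Consider this procedure: measure every $\tau$ time units until the metadata is nonzero and call that value $m_{\rm prev}$; then keep measuring every $\tau$ time units, and whenever the metadata equals $-m_{\rm prev}$, accept the current output and replace $m_{\rm prev}$ by $-m_{\rm prev}$. The embedding is a Las Vegas sampler for a distribution $\mathcal D$ if, from every initial configuration and for every $\tau>0$, almost surely infinitely many outputs are accepted and the accepted outputs are independent samples from $\mathcal D$. It is $(\tau,\delta)$-efficient if from every configuration, after time $\tau$, the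 metadata is $-1$ with probability at least $1-\delta$ and is $1$ with probability at least $1-\delta$. **Input machine.** Let $M$ be a reversible general machine that samples from $\mathcal D$ with $r\ge 0$ random bits: there are distinct input configurations $I_b$, $b\in\{0,1\}^r$, without predecessors, such that $M$ started in $I_b$ halts with output $g(b)$, where $g(b)\sim\mathcal D$ for uniformly random $b$. Let $T$ be such that for every $b$ the chain of configurations visited from $I_b$ (including $I_b$) has at most $T$ elements. **Construction of $M^*$.** Elongate every input chain of $M$ to exactly $T$ configurations, and then append $2T+r+1$ more, by adding redundant configurations that keep the output of the chain's terminal configuration. Let $M'_b$ be the resulting chain of $3T+r+1$ configurations for the input $b$. The randomizer consists of columns $0,\dots,r$, each with one node for every bitstring of length $r+1$ (bits numbered from $0$); a node in column $i<r$ is joined to the two nodes in column $i+1$ whose bitstrings agree with its own except possibly in bit $i$. On each side of the randomizer put two copies of every $M'_b$. On the right, the two nodes of column $r$ whose first $r$ bits are $b$ are joined to the first configurations of both copies of $M'_b$; on the left the same is done with column $0$. For every $t$, the $t$-th configuration of each copy of $M'_b$ is joined to the $(t+1)$-st configuration of both copies of $M'_b$ on the same side. All edges are directed from left to right (so the left chains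 are mirrored). The metadata is $-1$ on the left and $1$ on the right at all chain configurations after the first $T$ of their chain, and $0$ everywhere else; the output register of all randomizer nodes holds one fixed arbitrary value. **Theorem.** There are universal constants $c_1,c_2>0$ such that for all $M,\mathcal D,r,T$ as above, every adiabatic physical embedding of $M^*$, with rate constant $k$, is a Las Vegas sampler for $\mathcal D$ and is $(\Theta(T^2+r^2),3/4)$-efficient, in the following sense: 1. it is $(\tau,3/4)$-efficient for every $\tau\ge c_2\,(T^2+r^2)/k$, that is, after waiting such a time each of the metadata values $-1$ and $1$ is seen with probability at least $1/4$, from any starting configuration; 2. conversely, if it is $(\tau,3/4)$-efficient for some $\tau\ge 0$, then $\tau\ge c_1\,(T^2+r^2)/k$. -/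

import Mathlib

open MeasureTheory ProbabilityTheory
open scoped NNReal ENNReal

/-- A general machine: a set `S` of configurations (taken to be finite wherever the machine is
used), each of which is a tuple (work register, metadata register, output register), and a
set-valued transition function. -/
structure GeneralMachine (S W K O : Type*) where
  work : S → W
  metadata : S → K
  output : S → O
  /-- A configuration is determined by the contents of its three registers. -/
  registers_injective : Function.Injective fun C => (work C, metadata C, output C)
  next : S → Set S

namespace GeneralMachine

section Basic

variable {S W K O : Type*} (M : GeneralMachine S W K O)

/-- Every configuration has at most one successor. -/
def IsDeterministic : Prop := ∀ C, (M.next C).Subsingleton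

/-- Every configuration has at most one successor and at most one predecessor. -/
def IsReversible : Prop := M.IsDeterministic ∧ ∀ D, {C | D ∈ M.next C}.Subsingleton

def IsTerminal (C : S) : Prop := M.next C = ∅

/-- `D` is reached from `C` in finitely many (possibly zero) steps. -/
def Reaches (C D : S) : Prop := Relation.ReflTransGen (fun A B => B ∈ M.next A) C D

/-- The machine, started in `C`, reaches a terminal configuration with output `o`. -/
def HaltsWithOutput (C : S) (o : O) : Prop :=
  ∃ D, M.Reaches C D ∧ M.IsTerminal D ∧ M.output D = o

/-- The number of configurations on the chain that starts at `C` (including `C`). -/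
noncomputable def chainLength (C : S) : ℕ := {D | M.Reaches C D}.ncard

/-- The position of `C` in its chain: the number of configurations on the chain up to and
including `C`, so that the first configuration of a chain has position `1`. -/
noncomputable def position (C : S) : ℕ := {D | M.Reaches D C}.ncard

end Basic

/-- `g : {0,1}^r → O` is a `𝒟`-generator: `g x ∼ 𝒟` for uniformly random `x`. -/
def _root_.IsGenerator {O : Type*} {r : ℕ} (𝒟 : PMF O) (g : (Fin r → Bool) → O) : Prop :=
  (PMF.uniformOfFintype (Fin r → Bool)).map g = 𝒟

/-- `M` is a reversible machine which samples from `𝒟` using `r` random bits: on the random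
bitstring `b` it starts in `input b`, the first configuration of a chain of its own, and it halts
with output `g b`, where `g` is a `𝒟`-generator. -/
structure Samples {S W K O : Type*} (M : GeneralMachine S W K O) {r : ℕ}
    (input : (Fin r → Bool) → S) (𝒟 : PMF O) : Prop where
  reversible : M.IsReversible
  input_injective : Function.Injective input
  input_initial : ∀ b C, input b ∉ M.next C
  computes : ∃ g : (Fin r → Bool) → O, IsGenerator 𝒟 g ∧ ∀ b, M.HaltsWithOutput (input b) (g b)

/-! ### Elongating the chains -/

section Elongate

variable {S W K O : Type*} (M : GeneralMachine S W K O) (L : ℕ)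

/-- The configurations of the machine in which every chain of `M` (of length at most `L`) is
elongated to exactly `L` configurations: the pair `(C, 0)` is the configuration `C` of `M`, and
`(C, p)` with `p > 0` and `C` terminal is the `p`-th redundant configuration appended after `C`. -/
def ElongConfig : Type _ :=
  {q : S × ℕ // q.2 = 0 ∨ (M.IsTerminal q.1 ∧ M.position q.1 + q.2 ≤ L)}

instance [Finite S] : Finite (M.ElongConfig L) := by
  have : Function.Injective (fun q : M.ElongConfig L =>
      ((q.1.1, ⟨q.1.2, by rcases q.2 with h | h <;> omega⟩) : S × Fin (L + 1))) := by
    rintro ⟨⟨a, m⟩, _⟩ ⟨⟨b, n⟩, _⟩ h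
    simp only [Prod.mk.injEq, Fin.mk.injEq] at h
    exact Subtype.ext (Prod.ext h.1 h.2)
  exact Finite.of_injective _ this

/-- The machine `M` with all its chains elongated to length `L`. The work register is extended by a
counter, and the redundant configurations keep the output of the terminal configuration. -/
def elongate : GeneralMachine (M.ElongConfig L) (W × ℕ) K O where
  work q := (M.work q.1.1, q.1.2)
  metadata q := M.metadata q.1.1
  output q := M.output q.1.1
  registers_injective := by
    rintro ⟨⟨a, m⟩, _⟩ ⟨⟨b, n⟩, _⟩ h
    simp only [Prod.mk.injEq] at h
    have hab : a = b := M.registers_injective (by simp [h.1.1, h.2.1, h.2.2])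
    exact Subtype.ext (Prod.ext hab h.1.2)
  next q := {q' |
    (q.1.2 = 0 ∧ q'.1.2 = 0 ∧ q'.1.1 ∈ M.next q.1.1) ∨
    (M.IsTerminal q.1.1 ∧ q'.1.1 = q.1.1 ∧ q'.1.2 = q.1.2 + 1)}

/-- A configuration of `M`, as a configuration of the elongated machine. -/
def toElong (C : S) : M.ElongConfig L := ⟨(C, 0), Or.inl rfl⟩

end Elongate

/-! ### The Las Vegas construction -/

section LasVegas

variable {S W K O : Type*} (M : GeneralMachine S W K O) {r : ℕ} (input : (Fin r → Bool) → S)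
  (T : ℕ)

/-- The machine `M'`: all chains are elongated to length `T`, and every chain is then extended by
`2T + r + 1` output holding configurations. -/
abbrev withHolding : GeneralMachine (M.ElongConfig (T + (2 * T + r + 1))) (W × ℕ) K O :=
  M.elongate (T + (2 * T + r + 1))

/-- The configurations on the chains of `M'` that correspond to the inputs in `{0,1}^r`. -/
abbrev ChainConfig : Type _ :=
  {c : M.ElongConfig (T + (2 * T + r + 1)) //
    ∃ b, (M.withHolding (r := r) T).Reaches (M.toElong _ (input b)) c}

/-- The first configuration of the chain for the input `b`. -/
def chainStart (b : Fin r → Bool) : M.ChainConfig input T :=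
  ⟨M.toElong _ (input b), b, Relation.ReflTransGen.refl⟩

/-- A node of the randomizer: a column in `{0, …, r}` and a bitstring of length `r + 1`. -/
abbrev RandomizerNode (r : ℕ) : Type := Fin (r + 1) × (Fin (r + 1) → Bool)

/-- The configurations of `M*`: the nodes of the randomizer, and for each side (`false` is left of
the randomizer, `true` is right of it) two copies (named by the second Boolean) of the chains. -/
abbrev StarConfig : Type _ := RandomizerNode r ⊕ (Bool × Bool × M.ChainConfig input T)

/-- The edges of the state space of `M*`, directed from left to right.
Randomizer: a node in column `i` is joined to the nodes in column `i + 1` whose bitstrings differ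
from its own at most in bit `i`.
Links: for each `b`, the randomizer nodes in the outermost column whose first `r` bits are `b` are
joined to the starting configurations of both copies of the chain for `b` on that side.
Chains: consecutive configurations are joined, both within a copy and across the two copies; the
chains on the left are mirrored. -/
def starStep : M.StarConfig input T → M.StarConfig input T → Prop
  | .inl (i, x), .inl (j, y) => (j : ℕ) = (i : ℕ) + 1 ∧ ∀ l : Fin (r + 1), l ≠ i → x l = y l
  | .inl (i, x), .inr (true, _, c) =>
      i = Fin.last r ∧ c = M.chainStart input T fun l => x l.castSucc
  | .inr (false, _, c), .inl (j, y) =>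
      j = 0 ∧ c = M.chainStart input T fun l => y l.castSucc
  | .inr (true, _, c), .inr (true, _, d) => d.1 ∈ (M.withHolding (r := r) T).next c.1
  | .inr (false, _, c), .inr (false, _, d) => c.1 ∈ (M.withHolding (r := r) T).next d.1
  | _, _ => False

/-- The metadata of `M*`: `-1` (left) and `1` (right) on the chain configurations that come after
the first `T` configurations of their chain, and `0` everywhere else. -/
noncomputable def starMetadata : M.StarConfig input T → SignType
  | .inl _ => 0
  | .inr (side, _, c) =>
      if T < (M.withHolding (r := r) T).position c.1 then (if side then 1 else -1) else 0

/-- The machine `M*`. The output register of the randomizer nodes holds an arbitrary value `blank`,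
and the metadata register of `M` becomes a part of the work register. -/
noncomputable def lasVegas (blank : O) :
    GeneralMachine (M.StarConfig input T) (RandomizerNode r ⊕ (Bool × Bool × (W × ℕ) × K))
      SignType O where
  work
    | .inl n => .inl n
    | .inr (side, copy, c) =>
        .inr (side, copy, (M.withHolding (r := r) T).work c.1,
          (M.withHolding (r := r) T).metadata c.1)
  metadata := M.starMetadata input T
  output
    | .inl _ => blank
    | .inr (_, _, c) => (M.withHolding (r := r) T).output c.1
  registers_injective := by
    rintro (a | ⟨s, k, c⟩) (b | ⟨s', k', c'⟩) h
    · simp only [Prod.mk.injEq, Sum.inl.injEq] at h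
      rw [h.1]
    · simp at h
    · simp at h
    · simp only [Prod.mk.injEq, Sum.inr.injEq] at h
      obtain ⟨⟨h1, h2, h3, h4⟩, -, h5⟩ := h
      have : c.1 = c'.1 := (M.withHolding (r := r) T).registers_injective (by
        simp only [Prod.mk.injEq]
        exact ⟨h3, h4, h5⟩)
      rw [h1, h2, Subtype.ext this]
  next u := {v | M.starStep input T u v}

end LasVegas

end GeneralMachine

/-! ### Physical embeddings -/

/-- A physical embedding of `M`: an assignment of free energies to the configurations, together with
the kinetic rate constant `k` and the thermal energy `kT`, both positive. -/
structure PhysicalEmbedding {S W K O : Type*} (M : GeneralMachine S W K O) where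
  energy : S → ℝ
  k : ℝ
  k_pos : 0 < k
  kT : ℝ
  kT_pos : 0 < kT

namespace PhysicalEmbedding

section Dynamics

variable {S W K O : Type*} {M : GeneralMachine S W K O} (P : PhysicalEmbedding M)

/-- All configurations have the same free energy. -/
def IsAdiabatic : Prop := ∀ U V, P.energy U = P.energy V

open Classical in
/-- The rate of the transition from `U` to `V` under Metropolis dynamics: it is nonzero only if one
of `U`, `V` is a successor configuration of the other. -/
noncomputable def rate (U V : S) : ℝ :=
  if V ∈ M.next U ∨ U ∈ M.next V then
    if P.energy U < P.energy V then
      P.k * (Real.exp (-P.energy V / P.kT) / Real.exp (-P.energy U / P.kT))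
    else P.k
  else 0

variable [Finite S]

open Classical in
/-- The generator (matrix of transition rates) of the continuous-time Markov process. -/
noncomputable def generator : Matrix S S ℝ :=
  letI := Fintype.ofFinite S
  fun U V => if U = V then -∑ V' : S, (if V' = U then 0 else P.rate U V') else P.rate U V

open Classical in
/-- `P.transition t U V` is the probability that the process started in `U` is in `V` after
time `t`. -/
noncomputable def transition (t : ℝ) : Matrix S S ℝ :=
  letI := Fintype.ofFinite S
  NormedSpace.exp (t • P.generator)

/-- The probability that the process started in `U` is in the set `A` after time `t`. -/
noncomputable def probIn (t : ℝ) (U : S) (A : Set S) : ℝ :=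
  letI := Fintype.ofFinite S
  ∑ V : S, A.indicator (P.transition t U) V

/-- `X` is a continuous-time Markov process with the transition probabilities of the embedding,
started in `C₀`: its finite-dimensional distributions are the products of these. -/
structure IsEvolution {Ω : Type*} [MeasurableSpace Ω] (μ : Measure Ω) (C₀ : S)
    (X : ℝ≥0 → Ω → S) : Prop where
  measurable : ∀ t C, MeasurableSet {ω | X t ω = C}
  fdd : ∀ (n : ℕ) (t : ℕ → ℝ≥0), t 0 = 0 → Monotone t → ∀ x : ℕ → S, x 0 = C₀ →
    μ {ω | ∀ i ≤ n, X (t i) ω = x i} =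
      ENNReal.ofReal (∏ i ∈ Finset.range n,
        P.transition ((t (i + 1) : ℝ) - (t i : ℝ)) (x i) (x (i + 1)))

end Dynamics

end PhysicalEmbedding

/-! ### Las Vegas samplers -/

/-- The value of `m_prev` just before the `n`-th measurement, if the measured metadata values are
`m 0, m 1, …`; the value `0` means that no nonzero metadata has been measured yet. -/
def mPrev (m : ℕ → SignType) : ℕ → SignType
  | 0 => 0
  | n + 1 =>
    if mPrev m n = 0 then m n
    else if m n = -mPrev m n then -mPrev m n
    else mPrev m n

/-- The procedure accepts at the `n`-th measurement. -/
def Accepts (m : ℕ → SignType) (n : ℕ) : Prop := mPrev m n ≠ 0 ∧ m n = -mPrev m n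

namespace PhysicalEmbedding

section Samplers

variable {S W O : Type*} {M : GeneralMachine S W SignType O} (P : PhysicalEmbedding M)

/-- The configuration at the `n`-th measurement (`n = 0, 1, …`): a measurement is made every `τ`
time units, the first one at time `τ`. -/
noncomputable def measured {Ω : Type*} (X : ℝ≥0 → Ω → S) (τ : ℝ≥0) (ω : Ω) (n : ℕ) : S :=
  X ((n + 1) * τ) ω

variable (M) in
/-- The procedure accepts at the `n`-th measurement of the trajectory `ω`. -/
def AcceptsAt {Ω : Type*} (X : ℝ≥0 → Ω → S) (τ : ℝ≥0) (ω : Ω) (n : ℕ) : Prop :=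
  Accepts (fun i => M.metadata (measured X τ ω i)) n

variable (M) in
/-- The `j`-th accepted output (`j = 0, 1, …`) on the trajectory `ω`. -/
noncomputable def acceptedOutput {Ω : Type*} (X : ℝ≥0 → Ω → S) (τ : ℝ≥0) (j : ℕ) (ω : Ω) : O :=
  M.output (measured X τ ω (Nat.nth (AcceptsAt M X τ ω) j))

/-- Whatever the initial configuration and the time `τ > 0` between measurements, almost surely
infinitely many outputs are accepted, and the accepted outputs are independent samples
from `𝒟`. -/
def IsLasVegasSampler.{v} [Finite S] (𝒟 : PMF O) : Prop :=
  letI : MeasurableSpace O := ⊤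
  ∀ (Ω : Type v) [MeasurableSpace Ω] (μ : Measure Ω) [IsProbabilityMeasure μ] (C₀ : S)
    (X : ℝ≥0 → Ω → S), P.IsEvolution μ C₀ X → ∀ τ : ℝ≥0, 0 < τ →
      (∀ᵐ ω ∂μ, {n | AcceptsAt M X τ ω n}.Infinite) ∧
      iIndepFun (fun j => acceptedOutput M X τ j) μ ∧
      ∀ j, μ.map (acceptedOutput M X τ j) = 𝒟.toMeasure

/-- From any configuration, after waiting time `τ`, each of the two metadata values `-1` and `1` is
measured with probability at least `1 - δ`. -/
def IsEfficient [Finite S] (τ δ : ℝ) : Prop :=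
  ∀ C₀ : S, 1 - δ ≤ P.probIn τ C₀ {C | M.metadata C = -1} ∧
    1 - δ ≤ P.probIn τ C₀ {C | M.metadata C = 1}

end Samplers

end PhysicalEmbedding

/-! Read from left to right, the configurations of `M*` form 3H levels with H = 2T + r + 1, and each
level is a copy of the bitstrings of length r + 1. On the chains the first r bits name the input and
the last bit names the copy. Every edge joins consecutive levels and may change only one bit, the
free bit of that gap (`LayeredCube`, `IsChainEnumeration.layeredCube`). The metadata is -1 on the
lower third, 0 on the middle third and 1 on the upper third.

Efficiency. Each configuration has two neighbours in each adjacent level, so the level performs a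
symmetric walk with rate 2k on a reflecting path (`LayeredCube.lumpsToPath`). A bounded solution of
a Poisson equation shows that at some time before t the walk started at the bottom is in the upper
third with probability close to 1/3. Monotonicity, in time for this start and then in the starting
level, extends the bound to time t and to every start (`LumpsToPath.quarter_le_upper_third`).
Conversely, the squared level grows at speed at most 4k on average, so the upper third cannot be
reached much before time H^2/k (`LumpsToPath.le_of_quarter_le_upper_third`).

Independence. Fix a direction of travel and call a bit fresh at a level if it is the free bit of a
randomizer gap between that level and the starting side. Consider the observables that on each level
depend only on fresh bits and have mean zero. They form a subspace invariant under the dynamics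
(`LayeredCube.mulVec_mem_centered`), however often the walk turns back, because a step across a gap
averages over its free bit. On the starting side no bit is fresh, so these observables vanish there.
On the other side all r input bits are fresh, so the deviation of the output from its target law is
such an observable. Induction over the measurements shows that, on any event of the history since
the last nonzero metadata, these observables have expectation zero (`IsFreshSampler.sum_eq_zero`).
Hence each accepted output has the right law given the past; summing over the acceptance times gives
independence. For any τ, sufficiently many measurement steps together exceed the mixing time, so
both metadata values recur almost surely and infinitely many outputs are accepted. -/

namespace Matrix

/-! ### Semigroups of generators: invariant cones, positivity and drift bounds. -/

section Exponential

variable {S : Type*} [Fintype S] [DecidableEq S]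

/-- The partial sums of the exponential series applied to `f` are nonnegative combinations of the
vectors `A ^ n *ᵥ f`, and the closed cone contains their limit. -/
theorem exp_mulVec_mem_of_mulVec_mem {A : Matrix S S ℝ} {K : PointedCone ℝ (S → ℝ)}
    (hK : IsClosed (K : Set (S → ℝ))) (hA : ∀ f ∈ K, A *ᵥ f ∈ K) {f : S → ℝ} (hf : f ∈ K) :
    NormedSpace.exp A *ᵥ f ∈ K := by
  let _ : NormedRing (Matrix S S ℝ) := Matrix.linftyOpNormedRing
  let _ : NormedAlgebra ℝ (Matrix S S ℝ) := Matrix.linftyOpNormedAlgebra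
  have hs := NormedSpace.exp_series_hasSum_exp' (𝕂 := ℝ) A
  have hs' := hs.map (AddMonoidHom.mk' (fun B : Matrix S S ℝ => B *ᵥ f)
    fun B C => Matrix.add_mulVec B C f) (by
      show Continuous fun B : Matrix S S ℝ => B *ᵥ f
      fun_prop)
  have hpow : ∀ n : ℕ, A ^ n *ᵥ f ∈ K := by
    intro n
    induction n with
    | zero => simpa using hf
    | succ n ih =>
      rw [pow_succ', ← Matrix.mulVec_mulVec]
      exact hA _ ih
  refine hK.mem_of_tendsto hs' (Filter.Eventually.of_forall fun s => ?_)
  refine K.sum_mem fun n _ => ?_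
  show (((n.factorial : ℝ)⁻¹ • A ^ n) *ᵥ f) ∈ K
  rw [Matrix.smul_mulVec]
  exact K.smul_mem (by positivity) (hpow n)

/-- If `A + c` preserves a closed convex cone, then so does `exp (t A)` for every `t ≥ 0`. -/
theorem exp_smul_mulVec_mem {A : Matrix S S ℝ} {K : PointedCone ℝ (S → ℝ)}
    (hK : IsClosed (K : Set (S → ℝ))) (c : ℝ) (hA : ∀ f ∈ K, A *ᵥ f + c • f ∈ K) {t : ℝ}
    (ht : 0 ≤ t) {f : S → ℝ} (hf : f ∈ K) : NormedSpace.exp (t • A) *ᵥ f ∈ K := by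
  have hsplit : NormedSpace.exp (t • A) =
      Real.exp (-(t * c)) • NormedSpace.exp (t • (A + c • (1 : Matrix S S ℝ))) := by
    have h1 : t • A = (-(t * c)) • (1 : Matrix S S ℝ) + t • (A + c • (1 : Matrix S S ℝ)) := by
      rw [smul_add, smul_smul, neg_smul]
      abel
    have hc : Commute ((-(t * c)) • (1 : Matrix S S ℝ)) (t • (A + c • (1 : Matrix S S ℝ))) :=
      (Commute.one_left _).smul_left _
    have h2 : NormedSpace.exp ((-(t * c)) • (1 : Matrix S S ℝ)) =
        Real.exp (-(t * c)) • (1 : Matrix S S ℝ) := by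
      rw [← Matrix.diagonal_one, ← Matrix.diagonal_smul, Matrix.exp_diagonal,
        ← Matrix.diagonal_smul]
      congr 1
      ext i
      simp [Pi.coe_exp, Real.exp_eq_exp_ℝ]
    rw [h1, Matrix.exp_add_of_commute _ _ hc, h2, smul_one_mul]
  have hmem : NormedSpace.exp (t • (A + c • (1 : Matrix S S ℝ))) *ᵥ f ∈ K := by
    refine exp_mulVec_mem_of_mulVec_mem hK (fun g hg => ?_) hf
    rw [Matrix.smul_mulVec, Matrix.add_mulVec, Matrix.smul_mulVec, Matrix.one_mulVec]
    exact K.smul_mem ht (hA g hg)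
  rw [hsplit, Matrix.smul_mulVec]
  exact K.smul_mem (by positivity) hmem

theorem hasDerivAt_exp_smul_mulVec (A : Matrix S S ℝ) (f : S → ℝ) (U : S) (t : ℝ) :
    HasDerivAt (fun s : ℝ => (NormedSpace.exp (s • A) *ᵥ f) U)
      ((NormedSpace.exp (t • A) *ᵥ (A *ᵥ f)) U) t := by
  let _ : NormedRing (Matrix S S ℝ) := Matrix.linftyOpNormedRing
  let _ : NormedAlgebra ℝ (Matrix S S ℝ) := Matrix.linftyOpNormedAlgebra
  have h := hasDerivAt_exp_smul_const (𝕂 := ℝ) A t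
  let φ : Matrix S S ℝ →ₗ[ℝ] ℝ :=
    { toFun := fun B => (B *ᵥ f) U
      map_add' := fun B C => by rw [Matrix.add_mulVec]; rfl
      map_smul' := fun a B => by rw [Matrix.smul_mulVec]; rfl }
  have hφ := (LinearMap.toContinuousLinearMap φ).hasFDerivAt.comp_hasDerivAt t h
  rw [Matrix.mulVec_mulVec]
  exact hφ

theorem exp_smul_mulVec_const {A : Matrix S S ℝ} {f : S → ℝ} (h : A *ᵥ f = 0) (t : ℝ) :
    NormedSpace.exp (t • A) *ᵥ f = f := by
  ext U
  have hd : ∀ s, HasDerivAt (fun s : ℝ => (NormedSpace.exp (s • A) *ᵥ f) U) 0 s := by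
    intro s
    simpa [h] using hasDerivAt_exp_smul_mulVec A f U s
  have := is_const_of_deriv_eq_zero (fun s => (hd s).differentiableAt) (fun s => (hd s).deriv) t 0
  simpa [NormedSpace.exp_zero] using this

end Exponential

end Matrix

namespace Matrix

section Semigroup

variable {S : Type*} [Fintype S] [DecidableEq S] {A : Matrix S S ℝ}

theorem exp_smul_mulVec_nonneg (hA : ∀ U V, U ≠ V → 0 ≤ A U V) {t : ℝ} (ht : 0 ≤ t) {f : S → ℝ}
    (hf : ∀ U, 0 ≤ f U) (U : S) : 0 ≤ (NormedSpace.exp (t • A) *ᵥ f) U := by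
  let K : PointedCone ℝ (S → ℝ) :=
    { carrier := {f | ∀ U, 0 ≤ f U}
      add_mem' := fun hf hg U => add_nonneg (hf U) (hg U)
      zero_mem' := fun _ => le_rfl
      smul_mem' := fun c _ hf U => mul_nonneg c.2 (hf U) }
  have hK : IsClosed (K : Set (S → ℝ)) := by
    show IsClosed {f : S → ℝ | ∀ U, 0 ≤ f U}
    simp only [Set.ofPred_forall]
    exact isClosed_iInter fun U => isClosed_le continuous_const (continuous_apply U)
  -- The shift dominates every diagonal entry, so the shifted matrix is entrywise nonnegative.
  refine exp_smul_mulVec_mem (K := K) hK (∑ V, |A V V|) (fun g hg W => ?_) ht hf U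
  have hdiag : -A W W ≤ ∑ V, |A V V| :=
    (neg_le_abs _).trans
      (Finset.single_le_sum (f := fun V => |A V V|) (fun _ _ => abs_nonneg _) (Finset.mem_univ W))
  have hoff : 0 ≤ ∑ V ∈ Finset.univ.erase W, A W V * g V :=
    Finset.sum_nonneg fun V hV => mul_nonneg (hA W V (Finset.ne_of_mem_erase hV).symm) (hg V)
  have hsum : (A *ᵥ g) W = A W W * g W + ∑ V ∈ Finset.univ.erase W, A W V * g V :=
    (Finset.add_sum_erase _ _ (Finset.mem_univ W)).symm
  have hW : 0 ≤ g W := hg W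
  simp only [Pi.add_apply, Pi.smul_apply, smul_eq_mul, hsum]
  nlinarith

theorem exp_smul_mulVec_mono (hA : ∀ U V, U ≠ V → 0 ≤ A U V) {t : ℝ} (ht : 0 ≤ t)
    {f g : S → ℝ} (hfg : ∀ U, f U ≤ g U) (U : S) :
    (NormedSpace.exp (t • A) *ᵥ f) U ≤ (NormedSpace.exp (t • A) *ᵥ g) U := by
  have h := exp_smul_mulVec_nonneg hA ht (f := g - f) (fun V => sub_nonneg.2 (hfg V)) U
  rwa [Matrix.mulVec_sub, Pi.sub_apply, sub_nonneg] at h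

theorem exp_smul_mulVec_const_fun (hA0 : A *ᵥ (fun _ => 1) = 0) (t C : ℝ) (U : S) :
    (NormedSpace.exp (t • A) *ᵥ fun _ => C) U = C := by
  have h : A *ᵥ (fun _ => C) = 0 := by
    have : (fun _ : S => C) = C • fun _ => (1 : ℝ) := by ext; simp
    rw [this, Matrix.mulVec_smul, hA0, smul_zero]
  rw [exp_smul_mulVec_const h]

/-- The mean value theorem stands in for integrating the drift over [0, t]: a single intermediate
time is enough for all later uses. -/
theorem exists_exp_smul_mulVec_eq_slope (A : Matrix S S ℝ) (f : S → ℝ) (U : S) {t : ℝ}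
    (ht : 0 < t) : ∃ s ∈ Set.Ioo 0 t, (NormedSpace.exp (s • A) *ᵥ (A *ᵥ f)) U =
      ((NormedSpace.exp (t • A) *ᵥ f) U - f U) / t := by
  obtain ⟨s, hs, h⟩ := exists_hasDerivAt_eq_slope
    (fun s : ℝ => (NormedSpace.exp (s • A) *ᵥ f) U) _ ht
    (fun s _ => (hasDerivAt_exp_smul_mulVec A f U s).continuousAt.continuousWithinAt)
    (fun s _ => hasDerivAt_exp_smul_mulVec A f U s)
  exact ⟨s, hs, by simpa [NormedSpace.exp_zero] using h⟩

theorem exp_smul_mulVec_le (hA : ∀ U V, U ≠ V → 0 ≤ A U V) (hA0 : A *ᵥ (fun _ => 1) = 0)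
    {f : S → ℝ} {C : ℝ} (hf : ∀ U, (A *ᵥ f) U ≤ C) {t : ℝ} (ht : 0 ≤ t) (U : S) :
    (NormedSpace.exp (t • A) *ᵥ f) U ≤ f U + C * t := by
  rcases ht.eq_or_lt with rfl | ht
  · simp [NormedSpace.exp_zero]
  · obtain ⟨s, hs, h⟩ := exists_exp_smul_mulVec_eq_slope A f U ht
    have h1 := exp_smul_mulVec_mono hA hs.1.le hf U
    rw [exp_smul_mulVec_const_fun hA0, h, div_le_iff₀ ht] at h1
    linarith

theorem exp_smul_mulVec_comm (A : Matrix S S ℝ) (t : ℝ) (f : S → ℝ) :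
    NormedSpace.exp (t • A) *ᵥ (A *ᵥ f) = A *ᵥ (NormedSpace.exp (t • A) *ᵥ f) := by
  let _ : NormedRing (Matrix S S ℝ) := Matrix.linftyOpNormedRing
  let _ : NormedAlgebra ℝ (Matrix S S ℝ) := Matrix.linftyOpNormedAlgebra
  rw [Matrix.mulVec_mulVec, Matrix.mulVec_mulVec,
    (((Commute.refl A).smul_left t).exp_left).eq]

end Semigroup

/-! ### The symmetric walk on a path: mixing time bounds from both sides. -/

section Path

variable {S : Type*}

/-- Functions that are nondecreasing in the level. -/
def monotoneCone (lev : S → ℕ) : PointedCone ℝ (S → ℝ) where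
  carrier := {f | ∀ U V, lev U ≤ lev V → f U ≤ f V}
  add_mem' hf hg U V h := add_le_add (hf U V h) (hg U V h)
  zero_mem' _ _ _ := le_rfl
  smul_mem' c _ hf U V h := mul_le_mul_of_nonneg_left (hf U V h) c.2

theorem isClosed_monotoneCone (lev : S → ℕ) :
    IsClosed (monotoneCone lev : Set (S → ℝ)) := by
  show IsClosed {f : S → ℝ | ∀ U V, lev U ≤ lev V → f U ≤ f V}
  simp only [Set.ofPred_forall]
  exact isClosed_iInter fun U => isClosed_iInter fun V => isClosed_iInter fun _ =>
    isClosed_le (continuous_apply U) (continuous_apply V)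

variable [Fintype S]

/-- The generator `A` on functions of the level acts as `a` times the Laplacian of the path on
`{0, …, N - 1}`. -/
structure LumpsToPath (A : Matrix S S ℝ) (a : ℝ) (N : ℕ) (lev : S → ℕ) : Prop where
  lev_lt : ∀ U, lev U < N
  surj : ∀ j < N, ∃ U, lev U = j
  mulVec_comp : ∀ (w : ℕ → ℝ) (U : S), (A *ᵥ fun V => w (lev V)) U =
    a * ((if lev U + 1 < N then w (lev U + 1) - w (lev U) else 0) +
      (if 0 < lev U then w (lev U - 1) - w (lev U) else 0))

variable {A : Matrix S S ℝ} {a : ℝ} {N : ℕ} {lev : S → ℕ}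

/-- The symmetry of the path carries bounds on the upper third over to the lower third. -/
theorem LumpsToPath.reflect (h : A.LumpsToPath a N lev) :
    A.LumpsToPath a N fun U => N - 1 - lev U where
  lev_lt U := by have := h.lev_lt U; omega
  surj j hj := by
    obtain ⟨U, hU⟩ := h.surj (N - 1 - j) (by omega)
    exact ⟨U, by rw [hU]; omega⟩
  mulVec_comp w U := by
    have hU := h.lev_lt U
    rw [h.mulVec_comp (fun j => w (N - 1 - j)) U]
    have e1 : N - 1 - (lev U + 1) = N - 1 - lev U - 1 := by omega
    by_cases h1 : lev U + 1 < N <;> by_cases h2 : 0 < lev U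
    · have e2 : N - 1 - (lev U - 1) = N - 1 - lev U + 1 := by omega
      have h3 : N - 1 - lev U + 1 < N := by omega
      have h4 : 0 < N - 1 - lev U := by omega
      simp only [h1, h2, h3, h4, e1, e2, if_true]
      ring
    · have h3 : ¬ N - 1 - lev U + 1 < N := by omega
      have h4 : 0 < N - 1 - lev U := by omega
      simp only [h1, h2, h3, h4, e1, if_true, if_false]
      ring
    · have e2 : N - 1 - (lev U - 1) = N - 1 - lev U + 1 := by omega
      have h3 : N - 1 - lev U + 1 < N := by omega
      have h4 : ¬ 0 < N - 1 - lev U := by omega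
      simp only [h1, h2, h3, h4, e2, if_true, if_false]
      ring
    · have h3 : ¬ N - 1 - lev U + 1 < N := by omega
      have h4 : ¬ 0 < N - 1 - lev U := by omega
      simp only [h1, h2, h3, h4, if_false]

theorem LumpsToPath.mulVec_one (h : A.LumpsToPath a N lev) : A *ᵥ (fun _ => 1) = 0 := by
  ext U
  rw [h.mulVec_comp (fun _ => 1) U]
  simp

/-- At equal levels the inequality of the cone holds both ways, so its elements factor through the
level. -/
theorem LumpsToPath.exists_eq_comp (h : A.LumpsToPath a N lev) {f : S → ℝ}
    (hf : f ∈ monotoneCone lev) :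
    ∃ w : ℕ → ℝ, (∀ U, f U = w (lev U)) ∧ ∀ i j, i ≤ j → j < N → w i ≤ w j := by
  classical
  have hσ : ∀ j, ∃ x : ℝ, ∀ U, lev U = j → x = f U := by
    intro j
    by_cases hj : j < N
    · obtain ⟨U, hU⟩ := h.surj j hj
      exact ⟨f U, fun V hV => le_antisymm (hf U V (by omega)) (hf V U (by omega))⟩
    · exact ⟨0, fun V hV => absurd (h.lev_lt V) (by omega)⟩
  choose w hw using hσ
  refine ⟨w, fun U => (hw _ U rfl).symm, fun i j hij hj => ?_⟩
  obtain ⟨U, hU⟩ := h.surj i (by omega)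
  obtain ⟨V, hV⟩ := h.surj j hj
  rw [hw i U hU, hw j V hV]
  exact hf U V (by omega)

/-- This is attractiveness of the walk in analytic form. In the difference of the values at levels j
+ 1 and j, the shift `2 * a` cancels the two contributions of the increment between them; what
remains is `a` times the neighbouring increments, which are nonnegative. -/
theorem LumpsToPath.mulVec_add_mem_monotoneCone (h : A.LumpsToPath a N lev) (ha : 0 ≤ a)
    {f : S → ℝ} (hf : f ∈ monotoneCone lev) :
    A *ᵥ f + (2 * a) • f ∈ monotoneCone lev := by
  obtain ⟨w, hfw, hw⟩ := h.exists_eq_comp hf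
  obtain rfl : f = fun U => w (lev U) := funext hfw
  have key : ∀ j, ∀ U V, lev U = j → lev V = j + 1 →
      (A *ᵥ (fun U => w (lev U)) + (2 * a) • fun U => w (lev U)) U ≤
        (A *ᵥ (fun U => w (lev U)) + (2 * a) • fun U => w (lev U)) V := by
    intro j U V hU hV
    have hN := h.lev_lt V
    simp only [Pi.add_apply, Pi.smul_apply, smul_eq_mul, h.mulVec_comp, hU, hV]
    have e1 : 0 ≤ w (j + 1) - w j := sub_nonneg.2 (hw _ _ (by omega) (by omega))
    have e2 : 0 ≤ if j + 1 + 1 < N then w (j + 1 + 1) - w (j + 1) else 0 := by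
      split_ifs with h2
      · exact sub_nonneg.2 (hw _ _ (by omega) h2)
      · exact le_rfl
    have e3 : (if 0 < j then w (j - 1) - w j else 0) ≤ 0 := by
      split_ifs with h2
      · exact sub_nonpos.2 (hw _ _ (by omega) (by omega))
      · exact le_rfl
    have h1 : j + 1 < N := by omega
    simp only [h1, if_true, Nat.zero_lt_succ, Nat.add_sub_cancel]
    nlinarith
  have ind : ∀ d, ∀ U V, lev V = lev U + d →
      (A *ᵥ (fun U => w (lev U)) + (2 * a) • fun U => w (lev U)) U ≤
        (A *ᵥ (fun U => w (lev U)) + (2 * a) • fun U => w (lev U)) V := by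
    intro d
    induction d with
    | zero =>
      intro U V hUV
      simp only [Pi.add_apply, Pi.smul_apply, smul_eq_mul, h.mulVec_comp, hUV, add_zero, le_refl]
    | succ d ih =>
      intro U V hUV
      obtain ⟨X, hX⟩ := h.surj (lev U + d) (by have := h.lev_lt V; omega)
      exact (ih U X hX).trans (key _ X V hX hUV)
  intro U V hUV
  exact ind (lev V - lev U) U V (by omega)

variable [DecidableEq S]

/-- Starting anywhere, after a time of order `N ^ 2 / a` the walk is in the upper third of the path
with probability at least `1 / 4`. -/
theorem LumpsToPath.quarter_le_upper_third {H : ℕ} (h : A.LumpsToPath a (3 * H) lev) (ha : 0 < a)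
    (hA : ∀ U V, U ≠ V → 0 ≤ A U V) (hH : 0 < H) {t : ℝ}
    (ht : 12 * ((3 * H : ℕ) : ℝ) ^ 2 / a ≤ t) (U : S) :
    1 / 4 ≤ (NormedSpace.exp (t • A) *ᵥ fun V => if 2 * H ≤ lev V then (1 : ℝ) else 0) U := by
  set N := 3 * H with hN
  have hNpos : (0 : ℝ) < N := by exact_mod_cast (by omega : 0 < N)
  have htpos : 0 < t := lt_of_lt_of_le (by positivity) ht
  set ind : S → ℝ := fun V => if 2 * H ≤ lev V then (1 : ℝ) else 0 with hind
  set F : ℕ → ℝ := fun j => (if 2 * H ≤ j then (1 : ℝ) else 0) - 1 / 3 with hF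
  set d : ℕ → ℝ := fun j => ∑ i ∈ Finset.range (j + 1), F i with hd
  set ψ : ℕ → ℝ := fun l => ∑ j ∈ Finset.range l, d j with hψ
  have hFabs : ∀ j, |F j| ≤ 1 := by
    intro j
    simp only [hF]
    split_ifs <;> norm_num [abs_le]
  have hdabs : ∀ j < N, |d j| ≤ N := by
    intro j hj
    refine (Finset.abs_sum_le_sum_abs _ _).trans ((Finset.sum_le_card_nsmul _ _ 1
      fun i _ => hFabs i).trans ?_)
    simp only [Finset.card_range, nsmul_eq_mul, mul_one]
    exact_mod_cast hj
  have hψabs : ∀ l < N, |ψ l| ≤ N ^ 2 := by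
    intro l hl
    refine (Finset.abs_sum_le_sum_abs _ _).trans ((Finset.sum_le_card_nsmul _ _ (N : ℝ)
      fun i hi => hdabs i ?_).trans ?_)
    · have := Finset.mem_range.1 hi
      omega
    · simp only [Finset.card_range, nsmul_eq_mul, sq]
      have : (l : ℝ) ≤ N := by exact_mod_cast hl.le
      nlinarith
  -- This is the solvability condition: it makes `d` vanish at the last level, so that the equation
  -- also holds at the reflecting upper end.
  have hFsum : ∑ i ∈ Finset.range N, F i = 0 := by
    simp only [hF, Finset.sum_sub_distrib, Finset.sum_const, Finset.card_range, nsmul_eq_mul,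
      ← Finset.sum_filter]
    have : (Finset.range N).filter (fun i => 2 * H ≤ i) = Finset.Ico (2 * H) N := by
      ext i
      simp [Finset.mem_Ico, and_comm]
    rw [this, Nat.card_Ico, hN]
    have e : 3 * H - 2 * H = H := by omega
    rw [e]
    push_cast
    ring
  have hAψ : A *ᵥ (fun V => ψ (lev V)) = a • (ind - fun _ => (1 / 3 : ℝ)) := by
    ext V
    have hV := h.lev_lt V
    rw [h.mulVec_comp]
    simp only [Pi.smul_apply, Pi.sub_apply, smul_eq_mul]
    congr 1
    have e1 : ∀ l, ψ (l + 1) - ψ l = d l := fun l => by simp [hψ, Finset.sum_range_succ]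
    have e2 : ∀ l, d (l + 1) - d l = F (l + 1) := fun l => by
      simp only [hd]
      rw [Finset.sum_range_succ]
      ring
    have e3 : ind V - 1 / 3 = F (lev V) := rfl
    rw [e3, e1]
    generalize lev V = l at hV ⊢
    rcases l with _ | l
    · rw [if_pos (by omega), if_neg (by omega)]
      simp [hd]
    · rw [if_pos (Nat.succ_pos l), Nat.add_sub_cancel, ← neg_sub, e1]
      split_ifs with h1
      · rw [← e2]
        ring
      · have e4 : N = l + 1 + 1 := by omega
        rw [e4, Finset.sum_range_succ] at hFsum
        simp only [hd]
        linarith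
  obtain ⟨U₀, hU₀⟩ := h.surj 0 (by omega)
  have hmem : ∀ s : ℝ, 0 ≤ s → NormedSpace.exp (s • A) *ᵥ ind ∈ monotoneCone lev := by
    intro s hs
    refine exp_smul_mulVec_mem (isClosed_monotoneCone lev) (2 * a)
      (fun f hf => h.mulVec_add_mem_monotoneCone ha.le hf) hs ?_
    intro V W hVW
    simp only [hind]
    split_ifs
    · exact le_rfl
    · omega
    · exact zero_le_one
    · exact le_rfl
  -- At the time `s`, the deviation of the probability from 1/3 equals (mean of `ψ` at time `t`) /
  -- (a t), which is at least -N^2 / (a t). The assumed bound on `t` makes this at least -1/12 = 1/4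
  -- - 1/3.
  obtain ⟨s, hs, hslope⟩ :=
    exists_exp_smul_mulVec_eq_slope A (fun V => ψ (lev V)) U₀ htpos
  have hlow : -(N : ℝ) ^ 2 ≤ (NormedSpace.exp (t • A) *ᵥ fun V => ψ (lev V)) U₀ := by
    have := exp_smul_mulVec_mono hA htpos.le (f := fun _ => -(N : ℝ) ^ 2)
      (g := fun V => ψ (lev V)) (fun V => (abs_le.1 (hψabs _ (h.lev_lt V))).1) U₀
    rwa [exp_smul_mulVec_const_fun h.mulVec_one] at this
  have hs1 : 1 / 4 ≤ (NormedSpace.exp (s • A) *ᵥ ind) U₀ := by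
    rw [hAψ, Matrix.mulVec_smul, Matrix.mulVec_sub, Pi.smul_apply, Pi.sub_apply,
      exp_smul_mulVec_const_fun h.mulVec_one, hU₀, smul_eq_mul] at hslope
    have hψ0 : ψ 0 = 0 := by simp [hψ]
    rw [hψ0, sub_zero, eq_div_iff htpos.ne'] at hslope
    rw [div_le_iff₀ ha] at ht
    set X := (NormedSpace.exp (s • A) *ᵥ ind) U₀
    by_contra hX
    push Not at hX
    have h2 : a * (X - 1 / 3) * t < -(1 / 12) * (t * a) := by
      have : 0 < a * t := by positivity
      nlinarith
    nlinarith
  -- Seen from the bottom level, the time derivative is `a` times the first increment of a monotone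
  -- function, so the bound at `s` persists until `t`. The bottom level is moreover the worst
  -- starting point.
  have hmono : (NormedSpace.exp (s • A) *ᵥ ind) U₀ ≤ (NormedSpace.exp (t • A) *ᵥ ind) U₀ := by
    have hm : MonotoneOn (fun x : ℝ => (NormedSpace.exp (x • A) *ᵥ ind) U₀) (Set.Ici 0) := by
      refine monotoneOn_of_deriv_nonneg (convex_Ici 0)
        (fun x _ => (hasDerivAt_exp_smul_mulVec A ind U₀ x).continuousAt.continuousWithinAt)
        (fun x _ =>
          (hasDerivAt_exp_smul_mulVec A ind U₀ x).differentiableAt.differentiableWithinAt) ?_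
      intro x hx
      rw [interior_Ici, Set.mem_Ioi] at hx
      rw [(hasDerivAt_exp_smul_mulVec A ind U₀ x).deriv, exp_smul_mulVec_comm]
      obtain ⟨w, hfw, hw⟩ := h.exists_eq_comp (hmem x hx.le)
      rw [funext hfw, h.mulVec_comp, hU₀, if_neg (lt_irrefl 0), if_pos (by omega), add_zero]
      exact mul_nonneg ha.le (sub_nonneg.2 (hw _ _ (by omega) (by omega)))
    exact hm hs.1.le htpos.le hs.2.le
  exact hs1.trans (hmono.trans (hmem t htpos.le U₀ U (by omega)))

/-- If the walk started at the lower end is in the upper third of the path with probability at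
least `1 / 4`, then a time of order `N ^ 2 / a` has passed. -/
theorem LumpsToPath.le_of_quarter_le_upper_third {H : ℕ} (h : A.LumpsToPath a (3 * H) lev)
    (ha : 0 < a) (hA : ∀ U V, U ≠ V → 0 ≤ A U V) {t : ℝ} (ht : 0 ≤ t) {U : S} (hU : lev U = 0)
    (hq : 1 / 4 ≤ (NormedSpace.exp (t • A) *ᵥ fun V => if 2 * H ≤ lev V then (1 : ℝ) else 0) U) :
    (H : ℝ) ^ 2 / (2 * a) ≤ t := by
  -- The squared level has drift exactly `2 * a` in the interior and less at the ends.
  have hle := exp_smul_mulVec_le hA h.mulVec_one (f := fun V => (lev V : ℝ) ^ 2) (C := 2 * a)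
    (fun V => by
      rw [h.mulVec_comp (fun j => (j : ℝ) ^ 2) V]
      have : (if lev V + 1 < 3 * H then ((lev V + 1 : ℕ) : ℝ) ^ 2 - (lev V : ℝ) ^ 2 else 0) +
          (if 0 < lev V then ((lev V - 1 : ℕ) : ℝ) ^ 2 - (lev V : ℝ) ^ 2 else 0) ≤ 2 := by
        rcases lev V with _ | l
        · split_ifs <;> simp
        · rw [if_pos (Nat.succ_pos l), Nat.add_sub_cancel]
          have hl : (0 : ℝ) ≤ l := l.cast_nonneg
          split_ifs <;> push_cast <;> nlinarith
      nlinarith) ht U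
  -- Markov's inequality: the squared level is at least (2H)^2 on the upper third.
  have hge := exp_smul_mulVec_mono hA ht
    (f := ((2 * H : ℕ) : ℝ) ^ 2 • fun V => if 2 * H ≤ lev V then (1 : ℝ) else 0)
    (g := fun V => (lev V : ℝ) ^ 2) (fun V => by
      simp only [Pi.smul_apply, smul_eq_mul]
      split_ifs with h1
      · rw [mul_one]
        gcongr
      · rw [mul_zero]
        positivity) U
  rw [Matrix.mulVec_smul, Pi.smul_apply, smul_eq_mul] at hge
  rw [hU] at hle
  rw [div_le_iff₀ (by positivity)]
  push_cast at hge hle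
  nlinarith [sq_nonneg (H : ℝ)]

end Path

end Matrix

/-! ### Layered cubes: the projection to the level, and the observables on fresh bits. -/

open Matrix

/-- The bitstring `x` with the bit `i` flipped. -/
def flipBit {n : ℕ} (i : Fin n) (x : Fin n → Bool) : Fin n → Bool :=
  Function.update x i (!x i)

@[simp]
theorem flipBit_flipBit {n : ℕ} (i : Fin n) (x : Fin n → Bool) : flipBit i (flipBit i x) = x := by
  simp [flipBit]

theorem flipBit_of_ne {n : ℕ} {i l : Fin n} (h : l ≠ i) (x : Fin n → Bool) :
    flipBit i x l = x l := by
  simp [flipBit, h]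

theorem flipBit_ne {n : ℕ} (i : Fin n) (x : Fin n → Bool) : flipBit i x ≠ x := by
  intro h
  have := congrFun h i
  simp [flipBit] at this

theorem eq_or_eq_flipBit_iff {n : ℕ} {i : Fin n} {x y : Fin n → Bool} :
    (∀ l, l ≠ i → x l = y l) ↔ y = x ∨ y = flipBit i x := by
  constructor
  · intro h
    by_cases hi : y i = x i
    · left
      ext l
      by_cases hl : l = i
      · rw [hl, hi]
      · rw [h l hl]
    · right
      ext l
      by_cases hl : l = i
      · subst hl
        simp only [flipBit, Function.update_self]
        revert hi
        cases y l <;> cases x l <;> simp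
      · rw [flipBit_of_ne hl, h l hl]
  · rintro (rfl | rfl) l hl
    · rfl
    · rw [flipBit_of_ne hl]

theorem sum_comp_flipBit {n : ℕ} (i : Fin n) (f : (Fin n → Bool) → ℝ) :
    ∑ x, f (flipBit i x) = ∑ x, f x :=
  Equiv.sum_comp (Function.Involutive.toPerm (flipBit i) (flipBit_flipBit i)) f

/-- A graph on `N` levels, each of which is a copy of the set of bitstrings of length `n`. The nodes
of level `j` are joined to those nodes of level `j + 1` whose bitstrings agree with their own
except possibly in the bit `freeBit j`. -/
structure LayeredCube (n N : ℕ) {S : Type*} (step : S → S → Prop) where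
  level : S → ℕ
  bits : S → Fin n → Bool
  node : ℕ → (Fin n → Bool) → S
  freeBit : ℕ → Fin n
  level_lt : ∀ U, level U < N
  node_level_bits : ∀ U, node (level U) (bits U) = U
  level_node : ∀ j < N, ∀ x, level (node j x) = j
  bits_node : ∀ j < N, ∀ x, bits (node j x) = x
  step_iff : ∀ U V, step U V ↔
    level V = level U + 1 ∧ ∀ l, l ≠ freeBit (level U) → bits U l = bits V l

/-- The matrix `A` is the generator of the random walk which crosses each edge, in either
direction, with rate `k`. -/
def Matrix.IsWalkGenerator {S : Type*} [Fintype S] (A : Matrix S S ℝ) (k : ℝ)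
    (step : S → S → Prop) : Prop :=
  (∀ U V, U ≠ V → 0 ≤ A U V) ∧ ∀ (f : S → ℝ) (U : S),
    (A *ᵥ f) U = k * ∑ V, (({V | step U V} : Set S).indicator (fun V => f V - f U) V +
      ({V | step V U} : Set S).indicator (fun V => f V - f U) V)

namespace LayeredCube

variable {n N : ℕ} {S : Type*} {step : S → S → Prop} (G : LayeredCube n N step)

theorem eq_node_iff {j : ℕ} (hj : j < N) (x : Fin n → Bool) (U : S) :
    U = G.node j x ↔ G.level U = j ∧ G.bits U = x := by
  constructor
  · rintro rfl
    exact ⟨G.level_node j hj x, G.bits_node j hj x⟩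
  · rintro ⟨rfl, rfl⟩
    exact (G.node_level_bits U).symm

theorem node_injective {j : ℕ} (hj : j < N) {x y : Fin n → Bool}
    (h : G.node j x = G.node j y) : x = y := by
  rw [← G.bits_node j hj x, h, G.bits_node j hj y]

theorem forall_iff {p : S → Prop} : (∀ U, p U) ↔ ∀ j < N, ∀ x, p (G.node j x) := by
  constructor
  · intro h j _ x
    exact h _
  · intro h U
    rw [← G.node_level_bits U]
    exact h _ (G.level_lt U) _

theorem step_node_iff {j : ℕ} (hj : j < N) (x : Fin n → Bool) (V : S) :
    step (G.node j x) V ↔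
      j + 1 < N ∧ (V = G.node (j + 1) x ∨ V = G.node (j + 1) (flipBit (G.freeBit j) x)) := by
  rw [G.step_iff, G.level_node j hj, G.bits_node j hj, eq_or_eq_flipBit_iff]
  constructor
  · rintro ⟨h1, h2⟩
    have hV := G.level_lt V
    refine ⟨by omega, ?_⟩
    rw [G.eq_node_iff (by omega), G.eq_node_iff (by omega)]
    exact h2.imp (fun h => ⟨h1, h⟩) fun h => ⟨h1, h⟩
  · rintro ⟨h1, h2⟩
    rw [G.eq_node_iff h1, G.eq_node_iff h1] at h2
    rcases h2 with h2 | h2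
    · exact ⟨h2.1, Or.inl h2.2⟩
    · exact ⟨h2.1, Or.inr h2.2⟩

theorem step_node_right_iff {j : ℕ} (hj : j < N) (x : Fin n → Bool) (V : S) :
    step V (G.node j x) ↔ 0 < j ∧
      (V = G.node (j - 1) x ∨ V = G.node (j - 1) (flipBit (G.freeBit (j - 1)) x)) := by
  rw [G.step_iff, G.level_node j hj, G.bits_node j hj]
  constructor
  · rintro ⟨rfl, h2⟩
    rw [Nat.add_sub_cancel, G.eq_node_iff (by omega), G.eq_node_iff (by omega)]
    refine ⟨Nat.succ_pos _, ?_⟩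
    rcases eq_or_eq_flipBit_iff.1 h2 with h | h
    · exact Or.inl ⟨rfl, h.symm⟩
    · exact Or.inr ⟨rfl, by rw [h, flipBit_flipBit]⟩
  · rintro ⟨h1, h2⟩
    have hj1 : j - 1 < N := by omega
    rw [G.eq_node_iff hj1, G.eq_node_iff hj1] at h2
    rcases h2 with ⟨h2, h3⟩ | ⟨h2, h3⟩
    · exact ⟨by omega, fun l _ => by rw [h3]⟩
    · exact ⟨by omega, fun l hl => by rw [h3, flipBit_of_ne (h2 ▸ hl)]⟩

/-- The functions which, at each level `j`, depend only on the bits in `B j`, and whose sum over each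
level vanishes. -/
def centered (B : ℕ → Set (Fin n)) : Submodule ℝ (S → ℝ) where
  carrier := {f | ∀ j < N, (∀ x y, (∀ l ∈ B j, x l = y l) → f (G.node j x) = f (G.node j y)) ∧
    ∑ x, f (G.node j x) = 0}
  add_mem' := by
    intro f g hf hg j hj
    refine ⟨fun x y h => ?_, ?_⟩
    · rw [Pi.add_apply, Pi.add_apply, (hf j hj).1 x y h, (hg j hj).1 x y h]
    · simp only [Pi.add_apply, Finset.sum_add_distrib, (hf j hj).2, (hg j hj).2, add_zero]
  zero_mem' := fun j hj => ⟨fun _ _ _ => rfl, by simp⟩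
  smul_mem' := by
    intro c f hf j hj
    refine ⟨fun x y h => ?_, ?_⟩
    · rw [Pi.smul_apply, Pi.smul_apply, (hf j hj).1 x y h]
    · simp only [Pi.smul_apply, ← Finset.smul_sum, (hf j hj).2, smul_zero]

variable {G} in
theorem mul_level_mem_centered {B : ℕ → Set (Fin n)} {f : S → ℝ}
    (hf : f ∈ G.centered B) (w : ℕ → ℝ) :
    (fun U => w (G.level U) * f U) ∈ G.centered B := by
  intro j hj
  simp only [G.level_node j hj]
  refine ⟨fun x y h => by rw [(hf j hj).1 x y h], ?_⟩
  rw [← Finset.mul_sum, (hf j hj).2, mul_zero]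

variable {G} in
-- With no bit to depend on, the function is constant on the level, and the vanishing sum makes the
-- constant 0.
theorem eq_zero_of_mem_centered {B : ℕ → Set (Fin n)} {f : S → ℝ}
    (hf : f ∈ G.centered B) {U : S}
    (hU : B (G.level U) = ∅) : f U = 0 := by
  obtain ⟨h1, h2⟩ := hf _ (G.level_lt U)
  have hc : ∀ x, f (G.node (G.level U) x) = f U := by
    intro x
    rw [h1 x (G.bits U) (by simp [hU]), G.node_level_bits]
  simp only [hc, Finset.sum_const, nsmul_eq_mul, mul_eq_zero] at h2
  exact h2.resolve_left (by simp)

variable [Fintype S]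

theorem _root_.sum_indicator_pair {a b : S} (hab : a ≠ b) {p : Prop} [Decidable p] {q : S → Prop}
    (hq : ∀ V, q V ↔ p ∧ (V = a ∨ V = b)) (f : S → ℝ) :
    ∑ V, ({V | q V} : Set S).indicator f V = if p then f a + f b else 0 := by
  classical
  split_ifs with hp
  · have : ∀ V, ({V | q V} : Set S).indicator f V =
        (if V = a then f V else 0) + (if V = b then f V else 0) := by
      intro V
      have hV : V ∈ ({V | q V} : Set S) ↔ V = a ∨ V = b := (hq V).trans (by simp [hp])
      by_cases h1 : V = a
      · have h2 : V ≠ b := fun h => hab (h1.symm.trans h)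
        rw [Set.indicator_of_mem (hV.2 (Or.inl h1)), if_pos h1, if_neg h2, add_zero]
      · by_cases h2 : V = b
        · rw [Set.indicator_of_mem (hV.2 (Or.inr h2)), if_neg h1, if_pos h2, zero_add]
        · rw [if_neg h1, if_neg h2, Set.indicator_of_notMem, add_zero]
          intro h
          rcases hV.1 h with h | h
          · exact h1 h
          · exact h2 h
    simp [this, Finset.sum_add_distrib]
  · refine Finset.sum_eq_zero fun V _ => Set.indicator_of_notMem (fun h => hp ((hq V).1 h).1) _

variable {A : Matrix S S ℝ} {k : ℝ}

theorem mulVec_node (hA : A.IsWalkGenerator k step) (f : S → ℝ) {j : ℕ} (hj : j < N)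
    (x : Fin n → Bool) : (A *ᵥ f) (G.node j x) =
      k * ((if j + 1 < N then f (G.node (j + 1) x) + f (G.node (j + 1) (flipBit (G.freeBit j) x)) -
          2 * f (G.node j x) else 0) +
        (if 0 < j then f (G.node (j - 1) x) + f (G.node (j - 1) (flipBit (G.freeBit (j - 1)) x)) -
          2 * f (G.node j x) else 0)) := by
  rw [hA.2, Finset.sum_add_distrib]
  congr 2
  · by_cases h : j + 1 < N
    · rw [sum_indicator_pair _ (G.step_node_iff hj x), if_pos h, if_pos h]
      · ring
      · exact fun e => flipBit_ne _ _ (G.node_injective h e).symm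
    · rw [if_neg h]
      refine Finset.sum_eq_zero fun V _ => Set.indicator_of_notMem (fun hV => h ?_) _
      exact ((G.step_node_iff hj x V).1 hV).1
  · have hj1 : j - 1 < N := by omega
    rw [sum_indicator_pair _ (G.step_node_right_iff hj x)]
    · split_ifs
      · ring
      · rfl
    · exact fun e => flipBit_ne _ _ (G.node_injective hj1 e).symm

/-- The rate doubles because every node has two neighbours in each adjacent level. -/
theorem lumpsToPath (hA : A.IsWalkGenerator k step) : A.LumpsToPath (2 * k) N G.level where
  lev_lt := G.level_lt
  surj j hj := ⟨G.node j fun _ => false, G.level_node j hj _⟩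
  mulVec_comp w := by
    rw [G.forall_iff]
    intro j hj x
    rw [G.mulVec_node hA _ hj]
    by_cases h1 : j + 1 < N
    · by_cases h2 : 0 < j
      · have h3 : j - 1 < N := by omega
        simp only [h1, h2, if_true, G.level_node j hj, G.level_node _ h1, G.level_node _ h3]
        ring
      · simp only [h1, h2, if_true, if_false, G.level_node j hj, G.level_node _ h1]
        ring
    · by_cases h2 : 0 < j
      · have h3 : j - 1 < N := by omega
        simp only [h1, h2, if_true, if_false, G.level_node j hj, G.level_node _ h3]
        ring
      · simp only [h1, h2, if_false, G.level_node j hj]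
        ring

variable {G} {B : ℕ → Set (Fin n)}

/-- Crossing a gap adds the values at two bitstrings that differ in its free bit, so the sum does
not depend on that bit, whether or not it was fresh. By `hB` all other bits have the same status on
both sides of the gap. Flipping a bit permutes a level, so the level sums stay zero. -/
theorem mulVec_mem_centered (hA : A.IsWalkGenerator k step)
    (hB : ∀ j, ∀ l ≠ G.freeBit j, l ∈ B j ↔ l ∈ B (j + 1)) {f : S → ℝ} (hf : f ∈ G.centered B) :
    A *ᵥ f ∈ G.centered B := by
  have hdep : ∀ i j, i < N → ∀ b, (∀ l ≠ b, l ∈ B i → l ∈ B j) → ∀ x y : Fin n → Bool,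
      (∀ l ∈ B j, x l = y l) → f (G.node i x) + f (G.node i (flipBit b x)) =
        f (G.node i y) + f (G.node i (flipBit b y)) := by
    intro i j hi b hij x y hxy
    by_cases hb : x b = y b
    · rw [(hf i hi).1 x y, (hf i hi).1 (flipBit b x) (flipBit b y)]
      · intro l hl
        by_cases hlb : l = b
        · subst hlb
          simp [flipBit, hb]
        · rw [flipBit_of_ne hlb, flipBit_of_ne hlb, hxy l (hij l hlb hl)]
      · intro l hl
        by_cases hlb : l = b
        · rw [hlb, hb]
        · exact hxy l (hij l hlb hl)
    -- When `x` and `y` differ in the free bit, the two summands are interchanged.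
    · rw [(hf i hi).1 x (flipBit b y), (hf i hi).1 (flipBit b x) y, add_comm]
      · intro l hl
        by_cases hlb : l = b
        · subst hlb
          simp only [flipBit, Function.update_self]
          revert hb
          cases x l <;> cases y l <;> simp
        · rw [flipBit_of_ne hlb, hxy l (hij l hlb hl)]
      · intro l hl
        by_cases hlb : l = b
        · subst hlb
          simp only [flipBit, Function.update_self]
          revert hb
          cases x l <;> cases y l <;> simp
        · rw [flipBit_of_ne hlb, hxy l (hij l hlb hl)]
  intro j hj
  refine ⟨fun x y hxy => ?_, ?_⟩
  · rw [G.mulVec_node hA f hj, G.mulVec_node hA f hj, (hf j hj).1 x y hxy]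
    congr 2
    · split_ifs with h
      · rw [hdep (j + 1) j h (G.freeBit j) (fun l hl => (hB j l hl).2) x y hxy]
      · rfl
    · split_ifs with h
      · obtain ⟨i, rfl⟩ : ∃ i, j = i + 1 := ⟨j - 1, by omega⟩
        rw [Nat.add_sub_cancel,
          hdep i (i + 1) (by omega) (G.freeBit i) (fun l hl => (hB i l hl).1) x y hxy]
      · rfl
  · simp only [G.mulVec_node hA f hj]
    rw [← Finset.mul_sum, Finset.sum_add_distrib]
    have hz : ∀ i < N, ∀ b, ∑ x, (f (G.node i x) + f (G.node i (flipBit b x)) -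
        2 * f (G.node j x)) = 0 := by
      intro i hi b
      rw [Finset.sum_sub_distrib, Finset.sum_add_distrib, ← Finset.mul_sum,
        sum_comp_flipBit b fun x => f (G.node i x), (hf i hi).2, (hf j hj).2]
      ring
    split_ifs with h1 h2 h2
    · rw [hz _ h1, hz _ (by omega)]
      ring
    · rw [hz _ h1]
      simp
    · rw [hz _ (by omega)]
      simp
    · simp

theorem exp_mulVec_mem_centered [DecidableEq S] (hA : A.IsWalkGenerator k step)
    (hB : ∀ j, ∀ l ≠ G.freeBit j, l ∈ B j ↔ l ∈ B (j + 1)) {f : S → ℝ} (hf : f ∈ G.centered B)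
    {t : ℝ} (ht : 0 ≤ t) : NormedSpace.exp (t • A) *ᵥ f ∈ G.centered B := by
  have := exp_smul_mulVec_mem (A := A) (K := PointedCone.ofSubmodule (G.centered B))
    (Submodule.closed_of_finiteDimensional (G.centered B)) 0
    (fun g hg => by
      rw [zero_smul, add_zero]
      exact mulVec_mem_centered hA hB hg) ht (f := f) hf
  exact this

end LayeredCube

/-! ### Discrete-time Markov chains and events of their past. -/

section MarkovChain

variable {S Ω : Type*}

/-- The set `H` of trajectories is determined by the values of the process up to time `n`. -/
def IsDeterminedBy (Y : ℕ → Ω → S) (n : ℕ) (H : Set Ω) : Prop :=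
  ∀ ω ω', (∀ i ≤ n, Y i ω = Y i ω') → ω ∈ H → ω' ∈ H

theorem IsDeterminedBy.mono {Y : ℕ → Ω → S} {n m : ℕ} {H : Set Ω} (h : IsDeterminedBy Y n H)
    (hnm : n ≤ m) : IsDeterminedBy Y m H :=
  fun ω ω' hω => h ω ω' fun i hi => hω i (hi.trans hnm)

/-- The trajectory up to time `n`. -/
def initialPart (Y : ℕ → Ω → S) (n : ℕ) (ω : Ω) : Fin (n + 1) → S := fun i => Y i ω

theorem setOf_initialPart_eq (Y : ℕ → Ω → S) (n : ℕ) (g : Fin (n + 1) → S) :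
    {ω | initialPart Y n ω = g} =
      {ω | ∀ i ≤ n, Y i ω = g ⟨min i n, by omega⟩} := by
  ext ω
  simp only [Set.mem_ofPred_eq, funext_iff, initialPart, Fin.forall_iff]
  constructor
  · intro h i hi
    simpa [Nat.min_eq_left hi] using h i (by omega)
  · intro h i hi
    have := h i (by omega)
    simpa [Nat.min_eq_left (by omega : i ≤ n)] using this

variable [MeasurableSpace Ω]

/-- The process `Y` is a homogeneous Markov chain with transition probabilities `Q`. -/
structure IsMarkovChain (μ : Measure Ω) (Q : Matrix S S ℝ) (Y : ℕ → Ω → S) : Prop where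
  measurable : ∀ n C, MeasurableSet {ω | Y n ω = C}
  step : ∀ (n : ℕ) (y : ℕ → S) (v : S),
    μ.real ({ω | ∀ i ≤ n, Y i ω = y i} ∩ {ω | Y (n + 1) ω = v}) =
      μ.real {ω | ∀ i ≤ n, Y i ω = y i} * Q (y n) v

variable {μ : Measure Ω} {Q : Matrix S S ℝ} {Y : ℕ → Ω → S}

theorem sum_measureReal_inter_eq {ι : Type*} [Fintype ι] [IsFiniteMeasure μ] {Z : Ω → ι}
    (hZ : ∀ i, MeasurableSet {ω | Z ω = i}) (E : Set Ω) (hE : MeasurableSet E) :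
    μ.real E = ∑ i, μ.real (E ∩ {ω | Z ω = i}) := by
  rw [← measureReal_biUnion_finset]
  · congr 1
    ext ω
    simp
  · intro i _ j _ hij
    refine Set.disjoint_left.2 fun ω h1 h2 => hij ?_
    exact h1.2.symm.trans h2.2
  · exact fun i _ => hE.inter (hZ i)

namespace IsMarkovChain

theorem measurableSet_cylinder (h : IsMarkovChain μ Q Y) (n : ℕ) (y : ℕ → S) :
    MeasurableSet {ω | ∀ i ≤ n, Y i ω = y i} := by
  simp only [Set.ofPred_forall]
  exact MeasurableSet.iInter fun i => MeasurableSet.iInter fun _ => h.measurable i (y i)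

theorem measurableSet_initialPart (h : IsMarkovChain μ Q Y) (n : ℕ) (g : Fin (n + 1) → S) :
    MeasurableSet {ω | initialPart Y n ω = g} := by
  rw [setOf_initialPart_eq]
  exact h.measurableSet_cylinder n fun i => g ⟨min i n, by omega⟩

theorem measurableSet_of_isDeterminedBy [Finite S] (h : IsMarkovChain μ Q Y) {n : ℕ} {H : Set Ω}
    (hH : IsDeterminedBy Y n H) : MeasurableSet H := by
  have : H = ⋃ g ∈ {g | ∃ ω ∈ H, initialPart Y n ω = g}, {ω | initialPart Y n ω = g} := by
    ext ω
    simp only [Set.mem_ofPred_eq, Set.mem_iUnion, exists_prop, exists_eq_right']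
    constructor
    · exact fun hω => ⟨ω, hω, rfl⟩
    · rintro ⟨ω', hω', h'⟩
      exact hH ω' ω (fun i hi => congrFun h' ⟨i, by omega⟩) hω'
  rw [this]
  exact MeasurableSet.biUnion (Set.to_countable _) fun g _ => h.measurableSet_initialPart n g

variable [Fintype S] [IsFiniteMeasure μ]

/-- The definition gives the Markov property for single cylinders only. An event determined by the
past contains or avoids each cylinder, so summing over the finitely many initial parts extends it.
-/
theorem measureReal_inter_succ (h : IsMarkovChain μ Q Y) {n : ℕ} {H : Set Ω}
    (hH : IsDeterminedBy Y n H) (v : S) :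
    μ.real (H ∩ {ω | Y (n + 1) ω = v}) = ∑ u, μ.real (H ∩ {ω | Y n ω = u}) * Q u v := by
  classical
  have hHm := h.measurableSet_of_isDeterminedBy hH
  have hcyl : ∀ g : Fin (n + 1) → S, μ.real (H ∩ {ω | Y (n + 1) ω = v} ∩
      {ω | initialPart Y n ω = g}) =
        μ.real (H ∩ {ω | initialPart Y n ω = g}) * Q (g (Fin.last n)) v := by
    intro g
    by_cases hg : ∃ ω ∈ H, initialPart Y n ω = g
    · obtain ⟨ω, hω, hωg⟩ := hg
      have hsub : {ω | initialPart Y n ω = g} ⊆ H := fun ω' hω' =>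
        hH ω ω' (fun i hi => congrFun (hωg.trans (Eq.symm hω')) ⟨i, by omega⟩) hω
      rw [Set.inter_assoc, Set.inter_comm {ω | Y (n + 1) ω = v}, ← Set.inter_assoc,
        Set.inter_eq_right.2 hsub, setOf_initialPart_eq,
        h.step n (fun i => g ⟨min i n, by omega⟩) v]
      congr 3
      simp [Fin.last]
    · have hemp : H ∩ {ω | initialPart Y n ω = g} = ∅ := by
        ext ω
        simp only [Set.mem_inter_iff, Set.mem_ofPred_eq, Set.mem_empty_iff_false, iff_false]
        exact fun hω => hg ⟨ω, hω⟩
      rw [Set.inter_right_comm, hemp]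
      simp
  have hl := sum_measureReal_inter_eq (μ := μ) (fun g => h.measurableSet_initialPart n g)
    (H ∩ {ω | Y (n + 1) ω = v}) (hHm.inter (h.measurable _ _))
  have hr : ∀ u, μ.real (H ∩ {ω | Y n ω = u}) =
      ∑ g : Fin (n + 1) → S, if g (Fin.last n) = u then
        μ.real (H ∩ {ω | initialPart Y n ω = g}) else 0 := by
    intro u
    rw [sum_measureReal_inter_eq (μ := μ) (fun g => h.measurableSet_initialPart n g)
      (H ∩ {ω | Y n ω = u}) (hHm.inter (h.measurable _ _))]
    refine Finset.sum_congr rfl fun g _ => ?_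
    split_ifs with hgu
    · congr 1
      ext ω
      simp only [Set.mem_inter_iff, Set.mem_ofPred_eq]
      constructor
      · exact fun hω => ⟨hω.1.1, hω.2⟩
      · exact fun hω => ⟨⟨hω.1, (congrFun hω.2 (Fin.last n)).trans hgu⟩, hω.2⟩
    · have hemp : H ∩ {ω | Y n ω = u} ∩ {ω | initialPart Y n ω = g} = ∅ := by
        ext ω
        simp only [Set.mem_inter_iff, Set.mem_ofPred_eq, Set.mem_empty_iff_false, iff_false]
        exact fun hω => hgu ((congrFun hω.2 (Fin.last n)).symm.trans hω.1.2)
      rw [hemp]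
      simp
  simp only [hl, hcyl, hr, Finset.sum_mul, ite_mul, zero_mul]
  rw [Finset.sum_comm]
  simp

theorem sum_measureReal_inter_succ (h : IsMarkovChain μ Q Y) {n : ℕ} {H : Set Ω}
    (hH : IsDeterminedBy Y n H) (f : S → ℝ) :
    ∑ v, μ.real (H ∩ {ω | Y (n + 1) ω = v}) * f v =
      ∑ u, μ.real (H ∩ {ω | Y n ω = u}) * (Q *ᵥ f) u := by
  simp only [h.measureReal_inter_succ hH, Finset.sum_mul, Matrix.mulVec, dotProduct,
    Finset.mul_sum, mul_assoc]
  exact Finset.sum_comm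

theorem sum_measureReal_inter_add [DecidableEq S] (h : IsMarkovChain μ Q Y) {n : ℕ} {H : Set Ω}
    (hH : IsDeterminedBy Y n H) (K : ℕ) (f : S → ℝ) :
    ∑ v, μ.real (H ∩ {ω | Y (n + K) ω = v}) * f v =
      ∑ u, μ.real (H ∩ {ω | Y n ω = u}) * ((Q ^ K) *ᵥ f) u := by
  induction K generalizing f with
  | zero => simp
  | succ K ih =>
    rw [← add_assoc, h.sum_measureReal_inter_succ (hH.mono (Nat.le_add_right n K)), ih,
      Matrix.mulVec_mulVec, pow_succ]

theorem measureReal_inter_mem (h : IsMarkovChain μ Q Y) {H : Set Ω} (hH : MeasurableSet H) (n : ℕ)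
    (A : Set S) :
    μ.real (H ∩ {ω | Y n ω ∈ A}) =
      ∑ v, μ.real (H ∩ {ω | Y n ω = v}) * A.indicator (fun _ => 1) v := by
  have hA : MeasurableSet {ω | Y n ω ∈ A} := by
    have : {ω | Y n ω ∈ A} = ⋃ v ∈ A, {ω | Y n ω = v} := by
      ext ω
      simp
    rw [this]
    exact MeasurableSet.biUnion (Set.to_countable _) fun v _ => h.measurable n v
  rw [sum_measureReal_inter_eq (μ := μ) (fun v => h.measurable n v) _ (hH.inter hA)]
  refine Finset.sum_congr rfl fun v _ => ?_
  by_cases hv : v ∈ A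
  · rw [Set.indicator_of_mem hv, mul_one]
    congr 1
    ext ω
    simp only [Set.mem_inter_iff, Set.mem_ofPred_eq]
    constructor
    · exact fun hω => ⟨hω.1.1, hω.2⟩
    · exact fun hω => ⟨⟨hω.1, hω.2 ▸ hv⟩, hω.2⟩
  · have hemp : H ∩ {ω | Y n ω ∈ A} ∩ {ω | Y n ω = v} = ∅ := by
      ext ω
      simp only [Set.mem_inter_iff, Set.mem_ofPred_eq, Set.mem_empty_iff_false, iff_false]
      exact fun hω => hv (hω.2 ▸ hω.1.2)
    rw [Set.indicator_of_notMem hv, mul_zero, hemp]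
    simp

/-- A set which is hit with probability at least `1 / 4` after `K` steps, from every starting point,
is visited infinitely often. -/
theorem ae_frequently_mem [DecidableEq S] (h : IsMarkovChain μ Q Y) {A : Set S} {K : ℕ}
    (hA : ∀ U, 1 / 4 ≤ ((Q ^ K) *ᵥ A.indicator fun _ => 1) U) :
    ∀ᵐ ω ∂μ, ∀ n, ∃ m ≥ n, Y m ω ∈ A := by
  rw [ae_all_iff]
  intro n
  -- `E j` is the event of missing the set at `j` times spaced `K` apart after `n`; each further
  -- attempt removes at least a quarter of its mass.
  set E : ℕ → Set Ω := fun j => {ω | ∀ i < j, Y (n + (i + 1) * K) ω ∉ A} with hE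
  have hdet : ∀ j, IsDeterminedBy Y (n + j * K) (E j) := by
    intro j ω ω' hω hωE i hi
    rw [← hω]
    · exact hωE i hi
    · have : (i + 1) * K ≤ j * K := Nat.mul_le_mul_right K hi
      omega
  have hEm : ∀ j, MeasurableSet (E j) := fun j => h.measurableSet_of_isDeterminedBy (hdet j)
  have hrec : ∀ j, μ.real (E (j + 1)) ≤ 3 / 4 * μ.real (E j) := by
    intro j
    have h1 := h.sum_measureReal_inter_add (hdet j) K (A.indicator fun _ => 1)
    rw [← h.measureReal_inter_mem (hEm j)] at h1
    have h2 : 1 / 4 * μ.real (E j) ≤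
        ∑ u, μ.real (E j ∩ {ω | Y (n + j * K) ω = u}) *
          ((Q ^ K) *ᵥ A.indicator fun _ => 1) u := by
      rw [sum_measureReal_inter_eq (μ := μ) (fun v => h.measurable (n + j * K) v) _ (hEm j),
        Finset.mul_sum]
      refine Finset.sum_le_sum fun u _ => ?_
      rw [mul_comm]
      exact mul_le_mul_of_nonneg_left (hA u) measureReal_nonneg
    have h3 : E (j + 1) = E j \ (E j ∩ {ω | Y (n + j * K + K) ω ∈ A}) := by
      ext ω
      have e : n + (j + 1) * K = n + j * K + K := by ring
      simp only [hE, Set.mem_ofPred_eq, Set.mem_sdiff, Set.mem_inter_iff, not_and]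
      rw [Nat.forall_lt_succ_right, e]
      constructor
      · exact fun hω => ⟨hω.1, fun _ => hω.2⟩
      · exact fun hω => ⟨hω.1, hω.2 hω.1⟩
    have h4 : MeasurableSet (E j ∩ {ω | Y (n + j * K + K) ω ∈ A}) := by
      refine (hEm j).inter (h.measurableSet_of_isDeterminedBy (n := n + j * K + K) ?_)
      intro ω ω' hω hωA
      rw [Set.mem_ofPred_eq, ← hω _ le_rfl]
      exact hωA
    rw [h3, measureReal_sdiff Set.inter_subset_left h4, h1]
    linarith
  have hpow : ∀ j, μ.real (E j) ≤ (3 / 4) ^ j * μ.real (E 0) := by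
    intro j
    induction j with
    | zero => simp
    | succ j ih =>
      rw [pow_succ']
      linarith [hrec j]
  have hsub : ∀ j, {ω | ¬ ∃ m ≥ n, Y m ω ∈ A} ⊆ E j := fun j ω hω i _ hmem =>
    hω ⟨_, Nat.le_add_right _ _, hmem⟩
  have hzero : μ.real {ω | ¬ ∃ m ≥ n, Y m ω ∈ A} ≤ 0 := by
    have hlim : Filter.Tendsto (fun j : ℕ => (3 / 4 : ℝ) ^ j * μ.real (E 0)) Filter.atTop
        (nhds 0) := by
      simpa using (tendsto_pow_atTop_nhds_zero_of_lt_one (r := (3 / 4 : ℝ)) (by norm_num)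
        (by norm_num)).mul_const (μ.real (E 0))
    exact ge_of_tendsto' hlim fun j => (measureReal_mono (hsub j)).trans (hpow j)
  have := le_antisymm hzero measureReal_nonneg
  rwa [measureReal_eq_zero_iff] at this

end IsMarkovChain

end MarkovChain

/-! ### The acceptance procedure on a fixed sequence of measurements. -/

section Procedure

theorem SignType.ne_neg_self {s : SignType} (hs : s ≠ 0) : s ≠ -s := by
  revert s
  decide

theorem SignType.eq_zero_of_ne {s x : SignType} (hs : s ≠ 0) (h : x ≠ -s) (h' : x ≠ s) :
    x = 0 := by
  revert s x
  decide

theorem SignType.eq_zero_of_zero_eq_neg {s : SignType} (h : 0 = -s) : s = 0 := by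
  revert s
  decide

/-- Thus `mPrev` is just the last nonzero measurement, with 0 as the initial value. -/
theorem mPrev_succ (m : ℕ → SignType) (n : ℕ) :
    mPrev m (n + 1) = if m n = 0 then mPrev m n else m n := by
  rw [mPrev]
  generalize mPrev m n = a
  generalize m n = b
  revert a b
  decide

theorem not_accepts_of_eq_zero {m : ℕ → SignType} {n : ℕ} (h : m n = 0) : ¬ Accepts m n := by
  rintro ⟨h1, h2⟩
  rw [h] at h2
  exact h1 (SignType.eq_zero_of_zero_eq_neg h2)

theorem mPrev_congr {m m' : ℕ → SignType} {n : ℕ} (h : ∀ i < n, m i = m' i) :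
    mPrev m n = mPrev m' n := by
  induction n with
  | zero => rfl
  | succ n ih => rw [mPrev_succ, mPrev_succ, h n n.lt_succ_self, ih fun i hi => h i (by omega)]

theorem accepts_congr {m m' : ℕ → SignType} {n : ℕ} (h : ∀ i ≤ n, m i = m' i) :
    Accepts m n ↔ Accepts m' n := by
  rw [Accepts, Accepts, mPrev_congr fun i hi => h i hi.le, h n le_rfl]

/-- The first -1 after a measured 1 is accepted, because `mPrev` is still 1 at that moment. -/
theorem infinite_accepts {m : ℕ → SignType} (h1 : ∀ n, ∃ i ≥ n, m i = 1)
    (h2 : ∀ n, ∃ i ≥ n, m i = -1) : {n | Accepts m n}.Infinite := by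
  classical
  rw [Set.infinite_iff_exists_gt]
  intro n
  obtain ⟨i, hi, hmi⟩ := h1 (n + 1)
  have hex : ∃ d, m (i + 1 + d) = -1 := by
    obtain ⟨j, hj, hmj⟩ := h2 (i + 1)
    exact ⟨j - (i + 1), by rwa [Nat.add_sub_cancel' hj]⟩
  have hprev : ∀ d, (∀ e < d, m (i + 1 + e) ≠ -1) → mPrev m (i + 1 + d) = 1 := by
    intro d
    induction d with
    | zero =>
      intro _
      rw [add_zero, mPrev_succ, hmi, if_neg (by decide)]
    | succ d ih =>
      intro hd
      rw [← add_assoc, mPrev_succ, ih fun e he => hd e (by omega)]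
      have := hd d d.lt_succ_self
      revert this
      generalize m (i + 1 + d) = b
      revert b
      decide
  refine ⟨i + 1 + Nat.find hex, ?_, by omega⟩
  have hp := hprev _ fun e he => Nat.find_min hex he
  exact ⟨by rw [hp]; decide, by rw [hp]; exact Nat.find_spec hex⟩

open Classical in
/-- The number of outputs accepted before the `n`-th measurement. -/
noncomputable def acceptCount (m : ℕ → SignType) (n : ℕ) : ℕ := Nat.count (Accepts m) n

theorem acceptCount_succ_of_accepts {m : ℕ → SignType} {n : ℕ} (h : Accepts m n) :
    acceptCount m (n + 1) = acceptCount m n + 1 := by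
  classical
  simp [acceptCount, Nat.count_succ, h]

theorem acceptCount_succ_of_not_accepts {m : ℕ → SignType} {n : ℕ} (h : ¬ Accepts m n) :
    acceptCount m (n + 1) = acceptCount m n := by
  classical
  simp [acceptCount, Nat.count_succ, h]

theorem acceptCount_congr {m m' : ℕ → SignType} {n : ℕ} (h : ∀ i < n, m i = m' i) :
    acceptCount m n = acceptCount m' n := by
  induction n with
  | zero => simp [acceptCount]
  | succ n ih =>
    have ih' := ih fun i hi => h i (by omega)
    have hacc : Accepts m n ↔ Accepts m' n := accepts_congr fun i hi => h i (by omega)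
    by_cases ha : Accepts m n
    · rw [acceptCount_succ_of_accepts ha, acceptCount_succ_of_accepts (hacc.1 ha), ih']
    · rw [acceptCount_succ_of_not_accepts ha,
        acceptCount_succ_of_not_accepts (fun h => ha (hacc.2 h)), ih']

theorem nth_acceptCount {m : ℕ → SignType} {n : ℕ} (h : Accepts m n) :
    Nat.nth (Accepts m) (acceptCount m n) = n := by
  classical
  exact Nat.nth_count h

theorem acceptCount_nth {m : ℕ → SignType} (h : {n | Accepts m n}.Infinite) (j : ℕ) :
    acceptCount m (Nat.nth (Accepts m) j) = j := by
  classical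
  exact Nat.count_nth_of_infinite h j

/-- `Nat.nth` takes the default value 0 if there are too few acceptances; the second alternative
records this. The exact description makes the accepted outputs measurable everywhere, not only
almost everywhere. -/
theorem nth_accepts_eq_iff {m : ℕ → SignType} {j n : ℕ} :
    Nat.nth (Accepts m) j = n ↔ (Accepts m n ∧ acceptCount m n = j) ∨
      (n = 0 ∧ ∀ i, ¬ (Accepts m i ∧ acceptCount m i = j)) := by
  classical
  constructor
  · rintro rfl
    by_cases h : ∀ hf : (Set.ofPred (Accepts m)).Finite, j < hf.toFinset.card
    · exact Or.inl ⟨Nat.nth_mem j h, Nat.count_nth h⟩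
    · push Not at h
      obtain ⟨hf, hj⟩ := h
      refine Or.inr ⟨Nat.nth_of_card_le hf hj, ?_⟩
      rintro i ⟨hi, rfl⟩
      refine absurd hj (not_le.2 ?_)
      exact Nat.count_lt_card hf hi
  · rintro (⟨h, rfl⟩ | ⟨rfl, h⟩)
    · exact nth_acceptCount h
    · by_contra hne
      have hc : ∀ hf : (Set.ofPred (Accepts m)).Finite, j < hf.toFinset.card := by
        intro hf
        by_contra hj
        exact hne (Nat.nth_of_card_le hf (not_lt.1 hj))
      exact h _ ⟨Nat.nth_mem j hc, Nat.count_nth hc⟩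

end Procedure

/-! ### Independence and law of the accepted outputs, from invariant spaces of observables. -/

section Sampler

variable {S O Ω : Type*}

/-- The measured metadata values. -/
def metaSeq (metadata : S → SignType) (Y : ℕ → Ω → S) (ω : Ω) : ℕ → SignType :=
  fun i => metadata (Y i ω)

variable (metadata : S → SignType) (output : S → O) (Y : ℕ → Ω → S)

/-- Before the `n`-th measurement, exactly `J` outputs have been accepted, and the `j`-th of them
is in `B j`. -/
def acceptHistory (B : ℕ → Set O) (J n : ℕ) : Set Ω :=
  {ω | acceptCount (metaSeq metadata Y ω) n = J ∧ ∀ i < n, Accepts (metaSeq metadata Y ω) i →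
    output (Y i ω) ∈ B (acceptCount (metaSeq metadata Y ω) i)}

/-- The `j`-th accepted output. -/
noncomputable def outputSeq (j : ℕ) (ω : Ω) : O :=
  output (Y (Nat.nth (Accepts (metaSeq metadata Y ω)) j) ω)

variable {metadata output Y}

theorem metaSeq_congr {ω ω' : Ω} {i : ℕ} (h : Y i ω = Y i ω') :
    metaSeq metadata Y ω i = metaSeq metadata Y ω' i :=
  congrArg metadata h

theorem isDeterminedBy_acceptHistory (B : ℕ → Set O) (J n : ℕ) :
    IsDeterminedBy Y n (acceptHistory metadata output Y B J (n + 1)) := by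
  rintro ω ω' h ⟨h1, h2⟩
  refine ⟨?_, fun i hi ha => ?_⟩
  · rw [← h1]
    exact acceptCount_congr fun i hi => metaSeq_congr (h i (by omega)).symm
  · rw [← h i (by omega),
      acceptCount_congr fun l hl => metaSeq_congr (metadata := metadata) (h l (by omega)).symm]
    exact h2 i hi ((accepts_congr fun l hl => metaSeq_congr (h l (by omega))).2 ha)

theorem isDeterminedBy_mPrev (s : SignType) (n : ℕ) :
    IsDeterminedBy Y n {ω | mPrev (metaSeq metadata Y ω) (n + 1) = s} := by
  intro ω ω' h hω
  rw [Set.mem_ofPred_eq, ← mPrev_congr fun i hi => metaSeq_congr (h i (by omega))]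
  exact hω

theorem IsDeterminedBy.inter {n : ℕ} {H H' : Set Ω} (h : IsDeterminedBy Y n H)
    (h' : IsDeterminedBy Y n H') : IsDeterminedBy Y n (H ∩ H') :=
  fun ω ω' hω hωH => ⟨h ω ω' hω hωH.1, h' ω ω' hω hωH.2⟩

theorem isDeterminedBy_mem (n : ℕ) (A : Set S) : IsDeterminedBy Y n {ω | Y n ω ∈ A} := by
  intro ω ω' h hω
  rw [Set.mem_ofPred_eq, ← h n le_rfl]
  exact hω

theorem isDeterminedBy_accepts (n : ℕ) :
    IsDeterminedBy Y n {ω | Accepts (metaSeq metadata Y ω) n} :=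
  fun _ _ h hω => (accepts_congr fun i hi => metaSeq_congr (h i hi)).1 hω

theorem isDeterminedBy_acceptCount (J n : ℕ) :
    IsDeterminedBy Y n {ω | acceptCount (metaSeq metadata Y ω) n = J} := by
  intro ω ω' h hω
  rw [Set.mem_ofPred_eq, ← acceptCount_congr fun i hi => metaSeq_congr (h i hi.le)]
  exact hω

theorem mem_acceptHistory_succ_iff {B : ℕ → Set O} {J n : ℕ} {ω : Ω}
    (h : ¬ Accepts (metaSeq metadata Y ω) n) :
    ω ∈ acceptHistory metadata output Y B J (n + 1) ↔
      ω ∈ acceptHistory metadata output Y B J n := by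
  simp only [acceptHistory, Set.mem_ofPred_eq, acceptCount_succ_of_not_accepts h,
    Nat.forall_lt_succ_right]
  simp [h]

theorem forall_outputSeq_mem_iff {ω : Ω} (hω : {n | Accepts (metaSeq metadata Y ω) n}.Infinite)
    (B : ℕ → Set O) (J : ℕ) : (∀ j < J, outputSeq metadata output Y j ω ∈ B j) ↔
      ω ∈ acceptHistory metadata output Y B J (Nat.nth (Accepts (metaSeq metadata Y ω)) J) := by
  have hcn := acceptCount_nth hω
  constructor
  · intro h
    refine ⟨hcn J, fun i hi ha => ?_⟩
    have h1 : acceptCount (metaSeq metadata Y ω) i < J := by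
      rw [← Nat.nth_lt_nth hω, nth_acceptCount ha]
      exact hi
    have h2 := h _ h1
    rwa [outputSeq, nth_acceptCount ha] at h2
  · rintro ⟨-, h⟩ j hj
    have h2 := h _ ((Nat.nth_lt_nth hω).2 hj) (Nat.nth_mem_of_infinite hω j)
    rwa [hcn j] at h2

/-- For each direction `s` of travel, `V s` is a space of observables which is invariant under the
dynamics and under stopping, which vanish on the side from which the travel starts, and which
contains the deviations of the output distribution at the other side from `ν`. -/
structure IsFreshSampler [Fintype S] (Q : Matrix S S ℝ) (metadata : S → SignType) (output : S → O)
    (ν : Set O → ℝ≥0) (V : SignType → Submodule ℝ (S → ℝ)) : Prop where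
  mulVec_mem : ∀ s ≠ 0, ∀ f ∈ V s, Q *ᵥ f ∈ V s
  restrict_mem : ∀ s ≠ 0, ∀ f ∈ V s, (fun U => if metadata U = s then 0 else f U) ∈ V s
  eq_zero : ∀ s ≠ 0, ∀ f ∈ V s, ∀ U, metadata U = -s → f U = 0
  output_mem : ∀ s ≠ 0, ∀ B : Set O,
    (fun U => if metadata U = s then (output ⁻¹' B).indicator (fun _ => (1 : ℝ)) U - ν B else 0) ∈
      V s

variable [MeasurableSpace Ω] {μ : Measure Ω} {Q : Matrix S S ℝ}

theorem IsMarkovChain.measurable_outputSeq [Finite S] (h : IsMarkovChain μ Q Y) (j : ℕ) :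
    Measurable[_, ⊤] (outputSeq metadata output Y j) := by
  intro B _
  have : outputSeq metadata output Y j ⁻¹' B =
      ⋃ n, ({ω | Nat.nth (Accepts (metaSeq metadata Y ω)) j = n} ∩ {ω | output (Y n ω) ∈ B}) := by
    ext ω
    simp [outputSeq]
  rw [this]
  refine MeasurableSet.iUnion fun n => MeasurableSet.inter ?_
    (h.measurableSet_of_isDeterminedBy (isDeterminedBy_mem n (output ⁻¹' B)))
  have hm : ∀ i, MeasurableSet {ω | Accepts (metaSeq metadata Y ω) i ∧
      acceptCount (metaSeq metadata Y ω) i = j} := fun i =>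
    h.measurableSet_of_isDeterminedBy ((isDeterminedBy_accepts i).inter
      (isDeterminedBy_acceptCount j i))
  simp only [nth_accepts_eq_iff, Set.ofPred_or]
  refine (hm n).union ?_
  by_cases hn : n = 0
  · simp only [hn, true_and, Set.ofPred_forall]
    exact MeasurableSet.iInter fun i => (hm i).compl
  · simp [hn]

variable [Fintype S] [IsFiniteMeasure μ] {ν : Set O → ℝ≥0} {V : SignType → Submodule ℝ (S → ℝ)}

/-- The reason is a case distinction on the newest measurement. If it is -s, then `f` vanishes
there. If it is s, the event is excluded, so `f` may be replaced by its restriction off that side.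
If it is 0, the history does not change, and one step of the dynamics moves the sum back to the
previous time with another element of `V s`. -/
theorem IsFreshSampler.sum_eq_zero (hF : IsFreshSampler Q metadata output ν V)
    (h : IsMarkovChain μ Q Y) (B : ℕ → Set O) (J : ℕ) {s : SignType} (hs : s ≠ 0) (n : ℕ)
    {f : S → ℝ} (hf : f ∈ V s) :
    ∑ v, μ.real (acceptHistory metadata output Y B J (n + 1) ∩
      {ω | mPrev (metaSeq metadata Y ω) (n + 1) = -s} ∩ {ω | Y n ω = v}) * f v = 0 := by
  have hneg := SignType.ne_neg_self hs
  induction n generalizing f with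
  | zero =>
    refine Finset.sum_eq_zero fun v _ => ?_
    by_cases hv : metadata v = -s
    · rw [hF.eq_zero s hs f hf v hv, mul_zero]
    · rw [Set.eq_empty_of_forall_notMem (s := _ ∩ _ ∩ _), measureReal_empty, zero_mul]
      rintro ω ⟨⟨-, h1⟩, h2 : Y 0 ω = v⟩
      rw [Set.mem_ofPred_eq, mPrev_succ] at h1
      simp only [metaSeq, h2, mPrev] at h1
      split_ifs at h1 with h3
      · exact hs (SignType.eq_zero_of_zero_eq_neg h1)
      · exact hv h1
  | succ n ih =>
    have hdet := (isDeterminedBy_acceptHistory (metadata := metadata) (output := output) (Y := Y)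
      B J n).inter (isDeterminedBy_mPrev (metadata := metadata) (-s) n)
    have hg := hF.restrict_mem s hs f hf
    have h1 := h.sum_measureReal_inter_succ hdet fun U => if metadata U = s then 0 else f U
    rw [ih (hF.mulVec_mem s hs _ hg)] at h1
    rw [← h1]
    refine Finset.sum_congr rfl fun v _ => ?_
    by_cases hv : metadata v = -s
    · rw [hF.eq_zero s hs f hf v hv, ite_self, mul_zero, mul_zero]
    · by_cases hv' : metadata v = s
      · rw [if_pos hv', mul_zero, Set.eq_empty_of_forall_notMem (s := _ ∩ _ ∩ _),
          measureReal_empty, zero_mul]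
        rintro ω ⟨⟨-, h2⟩, h3 : Y (n + 1) ω = v⟩
        rw [Set.mem_ofPred_eq, mPrev_succ] at h2
        simp only [metaSeq, h3, hv', if_neg hs] at h2
        exact hneg h2
      · have hv0 := SignType.eq_zero_of_ne hs hv hv'
        rw [if_neg hv']
        congr 2
        ext ω
        simp only [Set.mem_inter_iff, Set.mem_ofPred_eq]
        refine and_congr_left fun h3 => ?_
        have hm : metaSeq metadata Y ω (n + 1) = 0 := by rw [metaSeq, h3, hv0]
        rw [mem_acceptHistory_succ_iff (not_accepts_of_eq_zero hm), mPrev_succ _ (n + 1), if_pos hm]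

/-- The difference of the two sides is the expectation of the deviation observable on side `s`. Its
image under `Q` lies in `V s`, so `IsFreshSampler.sum_eq_zero` at time `n` annihilates it. -/
theorem IsFreshSampler.measureReal_output (hF : IsFreshSampler Q metadata output ν V)
    (h : IsMarkovChain μ Q Y) (B : ℕ → Set O) (J : ℕ) {s : SignType} (hs : s ≠ 0) (n : ℕ)
    (B' : Set O) :
    μ.real (acceptHistory metadata output Y B J (n + 1) ∩
        {ω | mPrev (metaSeq metadata Y ω) (n + 1) = -s} ∩
          {ω | Y (n + 1) ω ∈ {v | metadata v = s ∧ output v ∈ B'}}) =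
      ν B' * μ.real (acceptHistory metadata output Y B J (n + 1) ∩
        {ω | mPrev (metaSeq metadata Y ω) (n + 1) = -s} ∩
          {ω | Y (n + 1) ω ∈ {v | metadata v = s}}) := by
  have hdet := (isDeterminedBy_acceptHistory (metadata := metadata) (output := output) (Y := Y)
    B J n).inter (isDeterminedBy_mPrev (metadata := metadata) (-s) n)
  have hm := h.measurableSet_of_isDeterminedBy hdet
  have h1 := h.sum_measureReal_inter_succ hdet fun U =>
    if metadata U = s then (output ⁻¹' B').indicator (fun _ => (1 : ℝ)) U - ν B' else 0
  rw [hF.sum_eq_zero h B J hs n (hF.mulVec_mem s hs _ (hF.output_mem s hs B'))] at h1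
  rw [h.measureReal_inter_mem hm, h.measureReal_inter_mem hm, ← sub_eq_zero, Finset.mul_sum,
    ← Finset.sum_sub_distrib, ← h1]
  refine Finset.sum_congr rfl fun v _ => ?_
  by_cases hv : metadata v = s
  · by_cases hB : output v ∈ B'
    · rw [if_pos hv, Set.indicator_of_mem (s := {v | metadata v = s ∧ output v ∈ B'}) ⟨hv, hB⟩,
        Set.indicator_of_mem (s := {v | metadata v = s}) hv,
        Set.indicator_of_mem (s := output ⁻¹' B') hB]
      ring
    · rw [if_pos hv, Set.indicator_of_notMem (s := {v | metadata v = s ∧ output v ∈ B'})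
          (fun h => hB h.2),
        Set.indicator_of_mem (s := {v | metadata v = s}) hv,
        Set.indicator_of_notMem (s := output ⁻¹' B') hB]
      ring
  · rw [if_neg hv, Set.indicator_of_notMem (s := {v | metadata v = s ∧ output v ∈ B'})
        (fun h => hv h.1),
      Set.indicator_of_notMem (s := {v | metadata v = s}) hv]
    ring

theorem IsFreshSampler.measure_accept (hF : IsFreshSampler Q metadata output ν V)
    (h : IsMarkovChain μ Q Y) (B : ℕ → Set O) (J n : ℕ) (B' : Set O) :
    μ (acceptHistory metadata output Y B J n ∩ {ω | Accepts (metaSeq metadata Y ω) n} ∩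
        {ω | output (Y n ω) ∈ B'}) =
      ν B' * μ (acceptHistory metadata output Y B J n ∩
        {ω | Accepts (metaSeq metadata Y ω) n}) := by
  rcases n with _ | n
  -- Nothing can be accepted at the first measurement, when `mPrev` is 0.
  · have : {ω | Accepts (metaSeq metadata Y ω) 0} = ∅ := by
      ext ω
      simp [Accepts, mPrev]
    simp [this]
  have hsplit : ∀ B'' : Set O, μ.real (acceptHistory metadata output Y B J (n + 1) ∩
      {ω | Accepts (metaSeq metadata Y ω) (n + 1)} ∩ {ω | output (Y (n + 1) ω) ∈ B''}) =
      ∑ s ∈ {1, -1}, μ.real (acceptHistory metadata output Y B J (n + 1) ∩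
        {ω | mPrev (metaSeq metadata Y ω) (n + 1) = -s} ∩
          {ω | Y (n + 1) ω ∈ {v | metadata v = s ∧ output v ∈ B''}}) := by
    intro B''
    rw [← measureReal_biUnion_finset]
    · congr 1
      ext ω
      simp only [Set.mem_inter_iff, Set.mem_ofPred_eq, Set.mem_iUnion, exists_prop,
        Finset.mem_insert, Finset.mem_singleton, Accepts, metaSeq]
      generalize mPrev (fun i => metadata (Y i ω)) (n + 1) = a
      generalize metadata (Y (n + 1) ω) = b
      have key : ∀ a b : SignType, (a ≠ 0 ∧ b = -a) ↔ ∃ s, (s = 1 ∨ s = -1) ∧ a = -s ∧ b = s := by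
        decide
      rw [key]
      constructor
      · rintro ⟨⟨h1, s, h2, h3, h4⟩, h5⟩
        exact ⟨s, h2, ⟨h1, h3⟩, h4, h5⟩
      · rintro ⟨s, h2, ⟨h1, h3⟩, h4, h5⟩
        exact ⟨⟨h1, s, h2, h3, h4⟩, h5⟩
    · intro s _ s' _ hss'
      refine Set.disjoint_left.2 fun ω h1 h2 => hss' ?_
      exact h1.2.1.symm.trans h2.2.1
    · intro s _
      exact (h.measurableSet_of_isDeterminedBy
        ((isDeterminedBy_acceptHistory B J n).inter (isDeterminedBy_mPrev (-s) n))).inter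
        (h.measurableSet_of_isDeterminedBy (isDeterminedBy_mem (n + 1) _))
  have hreal : μ.real (acceptHistory metadata output Y B J (n + 1) ∩
      {ω | Accepts (metaSeq metadata Y ω) (n + 1)} ∩ {ω | output (Y (n + 1) ω) ∈ B'}) =
      ν B' * μ.real (acceptHistory metadata output Y B J (n + 1) ∩
        {ω | Accepts (metaSeq metadata Y ω) (n + 1)}) := by
    have huniv := hsplit Set.univ
    simp only [Set.mem_univ, and_true, Set.ofPred_true, Set.inter_univ] at huniv
    rw [huniv, hsplit, Finset.mul_sum]
    refine Finset.sum_congr rfl fun s hs => hF.measureReal_output h B J ?_ n B'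
    revert hs s
    decide
  rw [← ENNReal.toReal_eq_toReal_iff' (measure_ne_top _ _)
    (ENNReal.mul_ne_top ENNReal.coe_ne_top (measure_ne_top _ _)), ENNReal.toReal_mul]
  exact hreal

theorem IsFreshSampler.measure_forall_outputSeq_mem (hF : IsFreshSampler Q metadata output ν V)
    (h : IsMarkovChain μ Q Y)
    (hinf : ∀ᵐ ω ∂μ, {n | Accepts (metaSeq metadata Y ω) n}.Infinite) (B : ℕ → Set O) (J : ℕ) :
    μ {ω | ∀ j < J, outputSeq metadata output Y j ω ∈ B j} =
      (∏ j ∈ Finset.range J, (ν (B j) : ℝ≥0∞)) * μ Set.univ := by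
  induction J with
  | zero => simp
  | succ J ih =>
    -- `D n` says that the output with index `J` is accepted at measurement `n` and that all earlier
    -- outputs lie in their sets. These events are disjoint, and up to a null set their union is the
    -- event of the induction hypothesis.
    set D : ℕ → Set Ω := fun n => acceptHistory metadata output Y B J n ∩
      {ω | Accepts (metaSeq metadata Y ω) n} with hD
    have hDm : ∀ n, MeasurableSet (D n) := fun n => by
      refine h.measurableSet_of_isDeterminedBy (n := n) (IsDeterminedBy.inter ?_
        (isDeterminedBy_accepts n))
      rcases n with _ | n
      · rintro ω ω' - ⟨h1, -⟩
        refine ⟨?_, fun i hi => absurd hi (Nat.not_lt_zero i)⟩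
        rw [← h1]
        simp [acceptCount]
      · exact (isDeterminedBy_acceptHistory B J n).mono (Nat.le_succ n)
    have hDd : Pairwise (Function.onFun Disjoint D) := by
      intro n n' hnn'
      refine Set.disjoint_left.2 fun ω h1 h2 => hnn' ?_
      rw [← nth_acceptCount h1.2, ← nth_acceptCount h2.2, h1.1.1, h2.1.1]
    have hDn : ∀ {ω : Ω}, {n | Accepts (metaSeq metadata Y ω) n}.Infinite → ∀ n,
        ω ∈ D n ↔ n = Nat.nth (Accepts (metaSeq metadata Y ω)) J ∧
          ∀ j < J, outputSeq metadata output Y j ω ∈ B j := by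
      intro ω hω n
      rw [forall_outputSeq_mem_iff hω]
      constructor
      · rintro ⟨h1, h2⟩
        have : n = Nat.nth (Accepts (metaSeq metadata Y ω)) J := by
          rw [← nth_acceptCount h2, h1.1]
        exact ⟨this, this ▸ h1⟩
      · rintro ⟨rfl, h1⟩
        exact ⟨h1, Nat.nth_mem_of_infinite hω J⟩
    have e1 : μ {ω | ∀ j < J, outputSeq metadata output Y j ω ∈ B j} = μ (⋃ n, D n) := by
      refine measure_congr ?_
      filter_upwards [hinf] with ω hω
      refine propext ?_
      show (∀ j < J, outputSeq metadata output Y j ω ∈ B j) ↔ ω ∈ ⋃ n, D n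
      simp [Set.mem_iUnion, hDn hω]
    have e2 : μ {ω | ∀ j < J + 1, outputSeq metadata output Y j ω ∈ B j} =
        μ (⋃ n, (D n ∩ {ω | output (Y n ω) ∈ B J})) := by
      refine measure_congr ?_
      filter_upwards [hinf] with ω hω
      refine propext ?_
      show (∀ j < J + 1, outputSeq metadata output Y j ω ∈ B j) ↔
        ω ∈ ⋃ n, (D n ∩ {ω | output (Y n ω) ∈ B J})
      simp only [Set.mem_iUnion, Set.mem_inter_iff, hDn hω, Nat.forall_lt_succ_right,
        Set.mem_ofPred_eq, and_assoc, exists_eq_left]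
      rfl
    have hOm : ∀ n, MeasurableSet {ω | output (Y n ω) ∈ B J} := fun n =>
      h.measurableSet_of_isDeterminedBy (isDeterminedBy_mem n (output ⁻¹' B J))
    rw [measure_iUnion hDd hDm] at e1
    rw [measure_iUnion (fun n n' hnn' => (hDd hnn').mono Set.inter_subset_left
      Set.inter_subset_left) fun n => (hDm n).inter (hOm n)] at e2
    rw [e2, Finset.prod_range_succ, mul_right_comm, ← ih, e1, mul_comm, ← ENNReal.tsum_mul_left]
    exact tsum_congr fun n => hF.measure_accept h B J n (B J)

theorem IsFreshSampler.iIndepFun_outputSeq [IsProbabilityMeasure μ]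
    (hF : IsFreshSampler Q metadata output ν V) (h : IsMarkovChain μ Q Y)
    (hinf : ∀ᵐ ω ∂μ, {n | Accepts (metaSeq metadata Y ω) n}.Infinite) :
    iIndepFun (m := fun _ => ⊤) (fun j => outputSeq metadata output Y j) μ ∧
      ∀ j B, μ (outputSeq metadata output Y j ⁻¹' B) = ν B := by
  -- Total mass one is not part of `IsFreshSampler`; it follows from the product formula for one
  -- unconstrained output.
  have hν : (ν Set.univ : ℝ≥0∞) = 1 := by
    have := hF.measure_forall_outputSeq_mem h hinf (fun _ => Set.univ) 1
    simpa using this.symm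
  have hfin : ∀ (s : Finset ℕ) (B : ℕ → Set O),
      μ (⋂ j ∈ s, outputSeq metadata output Y j ⁻¹' B j) = ∏ j ∈ s, (ν (B j) : ℝ≥0∞) := by
    classical
    intro s B
    have hs : ∀ j ∈ s, j < s.sup id + 1 := fun j hj =>
      Nat.lt_succ_of_le (Finset.le_sup (f := id) hj)
    have h1 := hF.measure_forall_outputSeq_mem h hinf
      (fun j => if j ∈ s then B j else Set.univ) (s.sup id + 1)
    rw [measure_univ, mul_one] at h1
    have h2 : {ω | ∀ j < s.sup id + 1, outputSeq metadata output Y j ω ∈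
        if j ∈ s then B j else Set.univ} = ⋂ j ∈ s, outputSeq metadata output Y j ⁻¹' B j := by
      ext ω
      simp only [Set.mem_ofPred_eq, Set.mem_iInter, Set.mem_preimage]
      constructor
      · intro hω j hj
        have := hω j (hs j hj)
        rwa [if_pos hj] at this
      · intro hω j _
        split_ifs with hj
        · exact hω j hj
        · trivial
    rw [h2] at h1
    rw [h1]
    symm
    have hsub : s ⊆ Finset.range (s.sup id + 1) := fun j hj => Finset.mem_range.2 (hs j hj)
    rw [← Finset.prod_subset hsub]
    · exact Finset.prod_congr rfl fun j hj => by rw [if_pos hj]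
    · intro j _ hj
      rw [if_neg hj, hν]
  have hone : ∀ j B, μ (outputSeq metadata output Y j ⁻¹' B) = ν B := by
    intro j B
    simpa using hfin {j} fun _ => B
  refine ⟨?_, hone⟩
  rw [iIndepFun_iff_measure_inter_preimage_eq_mul]
  intro s B _
  rw [hfin]
  exact Finset.prod_congr rfl fun j _ => (hone j (B j)).symm

end Sampler

/-! ### Adiabatic embeddings as walks, and their measured trajectories as Markov chains. -/

/-- The sequence `C₀, y 0, y 1, …`. -/
def prependState {S : Type*} (C₀ : S) (y : ℕ → S) : ℕ → S
  | 0 => C₀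
  | i + 1 => y i

namespace PhysicalEmbedding

variable {S W K O : Type*} {M : GeneralMachine S W K O} {P : PhysicalEmbedding M}

open Classical in
theorem IsAdiabatic.rate_eq (hP : P.IsAdiabatic) (U V : S) :
    P.rate U V = if V ∈ M.next U ∨ U ∈ M.next V then P.k else 0 := by
  rw [rate, hP U V]
  simp

/-- The sum over successors and predecessors would count a two-way edge twice, whereas its rate is
`k` only once; `hM` rules this out, and loops as well. -/
theorem IsAdiabatic.isWalkGenerator [Finite S] (hP : P.IsAdiabatic)
    (hM : ∀ U V, V ∈ M.next U → U ∉ M.next V) :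
    letI := Fintype.ofFinite S
    P.generator.IsWalkGenerator P.k fun U V => V ∈ M.next U := by
  classical
  let _ := Fintype.ofFinite S
  have hself : ∀ U, U ∉ M.next U := fun U h => hM U U h h
  refine ⟨fun U V hUV => ?_, fun f U => ?_⟩
  · rw [generator, if_neg hUV, hP.rate_eq]
    split_ifs
    exacts [P.k_pos.le, le_rfl]
  · have h1 : (P.generator *ᵥ f) U = ∑ V, (if V = U then 0 else P.rate U V) * (f V - f U) := by
      have h2 : ∀ V, P.generator U V * f V = (if V = U then 0 else P.rate U V) * f V -
          if V = U then (∑ V', if V' = U then 0 else P.rate U V') * f U else 0 := by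
        intro V
        rw [generator]
        by_cases hV : V = U
        · subst hV
          simp
        · rw [if_neg (Ne.symm hV), if_neg hV, if_neg hV, sub_zero]
      simp only [Matrix.mulVec, dotProduct, h2, Finset.sum_sub_distrib, Finset.sum_ite_eq',
        Finset.mem_univ, if_true, mul_sub, Finset.sum_mul]
    rw [h1, Finset.mul_sum]
    refine Finset.sum_congr rfl fun V _ => ?_
    rw [hP.rate_eq]
    by_cases hV : V = U
    · subst hV
      rw [Set.indicator_of_notMem (s := {U | U ∈ M.next V}) (hself V),
        Set.indicator_of_notMem (s := {U | V ∈ M.next U}) (hself V)]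
      simp
    · rw [if_neg hV]
      by_cases h3 : V ∈ M.next U
      · have h4 := hM U V h3
        rw [if_pos (Or.inl h3), Set.indicator_of_mem (s := {V | V ∈ M.next U}) h3,
          Set.indicator_of_notMem (s := {V | U ∈ M.next V}) h4, add_zero]
      · by_cases h4 : U ∈ M.next V
        · rw [if_pos (Or.inr h4), Set.indicator_of_notMem (s := {V | V ∈ M.next U}) h3,
            Set.indicator_of_mem (s := {V | U ∈ M.next V}) h4, zero_add]
        · rw [if_neg (not_or.2 ⟨h3, h4⟩), Set.indicator_of_notMem (s := {V | V ∈ M.next U}) h3,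
            Set.indicator_of_notMem (s := {V | U ∈ M.next V}) h4]
          ring

variable [Finite S] {Ω : Type*} [MeasurableSpace Ω] {μ : Measure Ω} [IsProbabilityMeasure μ]
  {C₀ : S} {X : ℝ≥0 → Ω → S}

theorem IsEvolution.measureReal_cylinder (hX : P.IsEvolution μ C₀ X)
    (hP : ∀ t : ℝ, 0 ≤ t → ∀ U V, 0 ≤ P.transition t U V) (τ : ℝ≥0) (n : ℕ) (y : ℕ → S) :
    μ.real {ω | ∀ i ≤ n, X ((i + 1) * τ) ω = y i} =
      ∏ i ∈ Finset.range (n + 1), P.transition τ (prependState C₀ y i) (y i) := by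
  set x : ℕ → S := prependState C₀ y with hx
  -- Measurements begin at time `τ` but the finite-dimensional distributions at time 0, so the
  -- almost sure starting point is added as an extra coordinate.
  have h0 : ∀ᵐ ω ∂μ, X 0 ω = C₀ := by
    have := hX.fdd 0 (fun _ => 0) rfl monotone_const (fun _ => C₀) rfl
    simp only [Nat.le_zero, forall_eq, Finset.range_zero, Finset.prod_empty,
      ENNReal.ofReal_one] at this
    rw [← prob_compl_eq_zero_iff (hX.measurable 0 C₀)] at this
    exact this
  have h1 := hX.fdd (n + 1) (fun i => i * τ) (by simp)
    (fun i j hij => mul_le_mul_of_nonneg_right (by exact_mod_cast hij) τ.2) x rfl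
  have h2 : μ {ω | ∀ i ≤ n, X ((i + 1) * τ) ω = y i} =
      μ {ω | ∀ i ≤ n + 1, X ((i : ℝ≥0) * τ) ω = x i} := by
    refine measure_congr ?_
    filter_upwards [h0] with ω hω
    refine propext ?_
    show (∀ i ≤ n, X ((i + 1) * τ) ω = y i) ↔ ∀ i ≤ n + 1, X ((i : ℝ≥0) * τ) ω = x i
    constructor
    · rintro h (_ | i) hi
      · simpa [hx, prependState] using hω
      · simpa [hx, prependState] using h i (by omega)
    · intro h i hi
      simpa [hx, prependState] using h (i + 1) (by omega)
  have hstep : ∀ i : ℕ, (((i + 1 : ℕ) : ℝ≥0) * τ : ℝ≥0) - (((i : ℝ≥0) * τ : ℝ≥0) : ℝ) = (τ : ℝ) := by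
    intro i
    push_cast
    ring
  rw [Measure.real, h2, h1, ENNReal.toReal_ofReal]
  · exact Finset.prod_congr rfl fun i _ => by rw [hstep, hx, prependState.eq_2]
  · exact Finset.prod_nonneg fun i _ => by
      rw [hstep]
      exact hP _ τ.2 _ _

theorem IsEvolution.isMarkovChain (hX : P.IsEvolution μ C₀ X)
    (hP : ∀ t : ℝ, 0 ≤ t → ∀ U V, 0 ≤ P.transition t U V) (τ : ℝ≥0) :
    IsMarkovChain μ (P.transition τ) fun n ω => X ((n + 1) * τ) ω where
  measurable n C := hX.measurable _ C
  step n y v := by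
    have h1 := hX.measureReal_cylinder hP τ n y
    have h2 := hX.measureReal_cylinder hP τ (n + 1) (Function.update y (n + 1) v)
    have h3 : {ω | ∀ i ≤ n, X ((i + 1) * τ) ω = y i} ∩
        {ω | X (((n + 1 : ℕ) + 1) * τ) ω = v} =
          {ω | ∀ i ≤ n + 1, X ((i + 1) * τ) ω = Function.update y (n + 1) v i} := by
      ext ω
      simp only [Set.mem_inter_iff, Set.mem_ofPred_eq]
      constructor
      · rintro ⟨h, h'⟩ i hi
        by_cases hin : i = n + 1
        · subst hin
          simpa using h'
        · rw [Function.update_of_ne hin]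
          exact h i (by omega)
      · intro h
        refine ⟨fun i hi => ?_, ?_⟩
        · have := h i (by omega)
          rwa [Function.update_of_ne (by omega)] at this
        · simpa using h (n + 1) le_rfl
    have h4 : prependState C₀ (Function.update y (n + 1) v) (n + 1) = y n := by
      rw [prependState, Function.update_of_ne (by omega)]
    rw [h3, h2, h1, Finset.prod_range_succ, Function.update_self, h4]
    congr 1
    refine Finset.prod_congr rfl fun i hi => ?_
    have hi' := Finset.mem_range.1 hi
    rw [Function.update_of_ne (by omega : i ≠ n + 1)]
    rcases i with _ | i
    · rfl
    · rw [prependState, prependState, Function.update_of_ne (by omega : i ≠ n + 1)]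

end PhysicalEmbedding

/-! ### Chains of reversible machines and their elongation. -/

namespace GeneralMachine

section Path

variable {S W K O : Type*} {M : GeneralMachine S W K O}

/-- `c 0, …, c n` is a maximal chain of configurations of `M`. -/
structure IsMaximalPath (M : GeneralMachine S W K O) (c : ℕ → S) (n : ℕ) : Prop where
  initial : ∀ C, c 0 ∉ M.next C
  step : ∀ t < n, c (t + 1) ∈ M.next (c t)
  terminal : M.IsTerminal (c n)

namespace IsMaximalPath

variable {c c' : ℕ → S} {n n' : ℕ}

theorem mem_next_iff (h : M.IsMaximalPath c n) (hM : M.IsReversible) {t : ℕ} (ht : t ≤ n) {D : S} :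
    D ∈ M.next (c t) ↔ t < n ∧ D = c (t + 1) := by
  constructor
  · intro hD
    have htn : t < n := by
      refine lt_of_le_of_ne ht ?_
      rintro rfl
      rw [h.terminal] at hD
      exact hD
    exact ⟨htn, hM.1 _ hD (h.step t htn)⟩
  · rintro ⟨htn, rfl⟩
    exact h.step t htn

/-- Predecessors are unique and first configurations have none, so tracing both chains backwards
reaches both beginnings at the same moment. In particular, chains of different inputs are disjoint.
-/
theorem eq_of_eq (h : M.IsMaximalPath c n) (h' : M.IsMaximalPath c' n') (hM : M.IsReversible)
    {t t' : ℕ} (ht : t ≤ n) (ht' : t' ≤ n') (he : c t = c' t') : c 0 = c' 0 ∧ t = t' := by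
  induction t generalizing t' with
  | zero =>
    rcases t' with _ | t'
    · exact ⟨he, rfl⟩
    · exact absurd (he ▸ h'.step t' (by omega)) (h.initial _)
  | succ t ih =>
    rcases t' with _ | t'
    · exact absurd (he ▸ h.step t (by omega)) (h'.initial _)
    · have h1 : c t = c' t' := hM.2 (c (t + 1)) (h.step t (by omega)) (by
        rw [he]
        exact h'.step t' (by omega))
      obtain ⟨h2, h3⟩ := ih (by omega) (by omega) h1
      exact ⟨h2, by rw [h3]⟩

theorem reaches (h : M.IsMaximalPath c n) {i t : ℕ} (hit : i ≤ t) (ht : t ≤ n) :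
    M.Reaches (c i) (c t) := by
  induction t, hit using Nat.le_induction with
  | base => exact Relation.ReflTransGen.refl
  | succ t _ ih => exact (ih (by omega)).tail (h.step t (by omega))

theorem reaches_iff (h : M.IsMaximalPath c n) (hM : M.IsReversible) {D : S} :
    M.Reaches (c 0) D ↔ ∃ t ≤ n, D = c t := by
  constructor
  · intro hD
    induction hD with
    | refl => exact ⟨0, Nat.zero_le n, rfl⟩
    | tail _ hstep ih =>
      obtain ⟨t, ht, rfl⟩ := ih
      obtain ⟨htn, rfl⟩ := (h.mem_next_iff hM ht).1 hstep
      exact ⟨t + 1, htn, rfl⟩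
  · rintro ⟨t, ht, rfl⟩
    exact h.reaches (Nat.zero_le t) ht

theorem reaches_right_iff (h : M.IsMaximalPath c n) (hM : M.IsReversible) {t : ℕ} (ht : t ≤ n)
    {D : S} : M.Reaches D (c t) ↔ ∃ i ≤ t, D = c i := by
  constructor
  · intro hD
    induction hD using Relation.ReflTransGen.head_induction_on with
    | refl => exact ⟨t, le_rfl, rfl⟩
    | head hstep _ ih =>
      obtain ⟨i, hi, rfl⟩ := ih
      rcases i with _ | i
      · exact absurd hstep (h.initial _)
      · exact ⟨i, by omega, hM.2 _ hstep (h.step i (by omega))⟩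
  · rintro ⟨i, hi, rfl⟩
    exact h.reaches hi ht

theorem injOn (h : M.IsMaximalPath c n) (hM : M.IsReversible) : Set.InjOn c (Set.Iic n) :=
  fun _ hi _ hj hij => (h.eq_of_eq h hM hi hj hij).2

theorem chainLength_eq (h : M.IsMaximalPath c n) (hM : M.IsReversible) :
    M.chainLength (c 0) = n + 1 := by
  have : {D | M.Reaches (c 0) D} = c '' Set.Iic n := by
    ext D
    simp only [Set.mem_ofPred_eq, h.reaches_iff hM, Set.mem_image, Set.mem_Iic, eq_comm]
  rw [chainLength, this, Set.InjOn.ncard_image (h.injOn hM), Set.ncard_eq_toFinset_card']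
  simp

theorem position_eq (h : M.IsMaximalPath c n) (hM : M.IsReversible) {t : ℕ} (ht : t ≤ n) :
    M.position (c t) = t + 1 := by
  have : {D | M.Reaches D (c t)} = c '' Set.Iic t := by
    ext D
    simp only [Set.mem_ofPred_eq, h.reaches_right_iff hM ht, Set.mem_image, Set.mem_Iic, eq_comm]
  rw [position, this, Set.InjOn.ncard_image
    ((h.injOn hM).mono (Set.Iic_subset_Iic.2 ht)), Set.ncard_eq_toFinset_card']
  simp

end IsMaximalPath

theorem Reaches.exists_seq {C D : S} (h : M.Reaches C D) :
    ∃ (c : ℕ → S) (n : ℕ), c 0 = C ∧ c n = D ∧ ∀ t < n, c (t + 1) ∈ M.next (c t) := by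
  induction h with
  | refl => exact ⟨fun _ => C, 0, rfl, rfl, fun t ht => absurd ht (Nat.not_lt_zero t)⟩
  | @tail D E _ hstep ih =>
    obtain ⟨c, n, h0, hn, hc⟩ := ih
    refine ⟨fun t => if t ≤ n then c t else E, n + 1, by simpa using h0, by simp, fun t ht => ?_⟩
    by_cases htn : t = n
    · subst htn
      simpa [hn] using hstep
    · have h1 : t + 1 ≤ n := by omega
      have h2 : t ≤ n := by omega
      simpa [h1, h2] using hc t (by omega)

theorem HaltsWithOutput.exists_isMaximalPath {C : S} {o : O} (h : M.HaltsWithOutput C o)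
    (hC : ∀ D, C ∉ M.next D) :
    ∃ (c : ℕ → S) (n : ℕ), M.IsMaximalPath c n ∧ c 0 = C ∧ M.output (c n) = o := by
  obtain ⟨D, hD, hT, hO⟩ := h
  obtain ⟨c, n, rfl, rfl, hc⟩ := Reaches.exists_seq hD
  exact ⟨c, n, ⟨hC, hc, hT⟩, rfl, hO⟩

theorem IsReversible.elongate (hM : M.IsReversible) (L : ℕ) : (M.elongate L).IsReversible := by
  constructor
  · rintro ⟨⟨C, p⟩, hC⟩ ⟨⟨D, q⟩, hD⟩ h ⟨⟨D', q'⟩, hD'⟩ h'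
    refine Subtype.ext (Prod.ext ?_ ?_)
    · rcases h with ⟨-, -, h⟩ | ⟨h1, h2, -⟩ <;> rcases h' with ⟨-, -, h'⟩ | ⟨h1', h2', -⟩
      · exact hM.1 C h h'
      · rw [h1'] at h
        exact h.elim
      · rw [h1] at h'
        exact h'.elim
      · exact h2.trans h2'.symm
    · rcases h with ⟨-, h0, h⟩ | ⟨h1, -, h2⟩ <;> rcases h' with ⟨-, h0', h'⟩ | ⟨h1', -, h2'⟩
      · exact h0.trans h0'.symm
      · rw [h1'] at h
        exact h.elim
      · rw [h1] at h'
        exact h'.elim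
      · exact h2.trans h2'.symm
  · rintro ⟨⟨D, q⟩, hD⟩ ⟨⟨C, p⟩, hC⟩ h ⟨⟨C', p'⟩, hC'⟩ h'
    refine Subtype.ext (Prod.ext ?_ ?_)
    · rcases h with ⟨-, h0, h⟩ | ⟨-, h1, h2⟩ <;> rcases h' with ⟨-, h0', h'⟩ | ⟨-, h1', h2'⟩
      · exact hM.2 D h h'
      · exact absurd (h0.symm.trans h2') (Nat.succ_ne_zero _).symm
      · exact absurd (h0'.symm.trans h2) (Nat.succ_ne_zero _).symm
      · exact h1.symm.trans h1'
    · rcases h with ⟨h3, h0, h⟩ | ⟨-, h1, h2⟩ <;> rcases h' with ⟨h3', h0', h'⟩ | ⟨-, h1', h2'⟩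
      · exact h3.trans h3'.symm
      · exact absurd (h0.symm.trans h2') (Nat.succ_ne_zero _).symm
      · exact absurd (h0'.symm.trans h2) (Nat.succ_ne_zero _).symm
      · exact Nat.succ_injective (h2.symm.trans h2')

theorem IsMaximalPath.exists_elongate {c : ℕ → S} {n : ℕ} (h : M.IsMaximalPath c n)
    (hM : M.IsReversible) {L : ℕ} (hL : n < L) :
    ∃ e : ℕ → M.ElongConfig L, (M.elongate L).IsMaximalPath e (L - 1) ∧ e 0 = M.toElong L (c 0) ∧
      ∀ t, n ≤ t → t < L → (M.elongate L).output (e t) = M.output (c n) := by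
  -- Truncated subtraction makes the counter 0 along the original chain; it then counts the
  -- redundant copies of the terminal configuration.
  have hmem : ∀ t, ∃ q : M.ElongConfig L, t < L → q.1 = (c (min t n), t - n) := by
    intro t
    by_cases ht : t < L
    · refine ⟨⟨(c (min t n), t - n), ?_⟩, fun _ => rfl⟩
      by_cases htn : t ≤ n
      · exact Or.inl (Nat.sub_eq_zero_of_le htn)
      · right
        rw [min_eq_right (by omega)]
        exact ⟨h.terminal, by rw [h.position_eq hM le_rfl]; simp only; omega⟩
    · exact ⟨M.toElong L (c 0), fun h => absurd h ht⟩
  choose e he using hmem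
  refine ⟨e, ⟨?_, ?_, ?_⟩, ?_, ?_⟩
  · intro q hq
    have h0 := he 0 (by omega)
    rw [Nat.zero_min, Nat.zero_sub] at h0
    rcases hq with ⟨-, -, h1⟩ | ⟨-, -, h1⟩
    · rw [h0] at h1
      exact h.initial _ h1
    · rw [h0] at h1
      exact absurd h1 (Nat.succ_ne_zero _).symm
  · intro t ht
    have h1 := he t (by omega)
    have h2 := he (t + 1) (by omega)
    by_cases htn : t < n
    · left
      rw [h1, h2, min_eq_left htn.le, min_eq_left (by omega : t + 1 ≤ n)]
      refine ⟨?_, ?_, h.step t htn⟩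
      · show t - n = 0
        omega
      · show t + 1 - n = 0
        omega
    · right
      rw [h1, h2, min_eq_right (by omega : n ≤ t), min_eq_right (by omega : n ≤ t + 1)]
      refine ⟨h.terminal, rfl, ?_⟩
      show t + 1 - n = t - n + 1
      omega
  -- The terminal configuration has position n + 1, so the bound on the counter in `ElongConfig`
  -- allows no redundant configuration after index L - 1.
  · have h1 := he (L - 1) (by omega)
    rw [min_eq_right (by omega : n ≤ L - 1)] at h1
    refine Set.eq_empty_of_forall_notMem ?_
    rintro ⟨⟨D, q⟩, hD⟩ hq
    rcases hq with ⟨-, -, h2⟩ | ⟨-, h2, h3⟩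
    · rw [h1, h.terminal] at h2
      exact h2
    · rw [h1] at h2 h3
      simp only at h2 h3
      subst h2
      rcases hD with hD | ⟨-, hD⟩
      · simp only at hD
        omega
      · simp only [h.position_eq hM le_rfl] at hD
        omega
  · refine Subtype.ext ?_
    rw [he 0 (by omega)]
    simp [toElong]
  · intro t hnt ht
    show M.output (e t).1.1 = _
    rw [he t ht, min_eq_right hnt]

end Path

end GeneralMachine

/-! ### The configurations of `M*` as a layered cube. -/

namespace GeneralMachine

section Star

variable {S W K O : Type*} {M : GeneralMachine S W K O} {r T : ℕ}
  {input : (Fin r → Bool) → S}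

/-- The bit which the edges from level `j` to level `j + 1` of `M*` randomize: the bits
`0, …, r - 1` in the randomizer, and the last bit, which distinguishes the two copies of the
chains, elsewhere. -/
def starFreeBit (r T j : ℕ) : Fin (r + 1) :=
  if h : T + (2 * T + r + 1) ≤ j ∧ j < T + (2 * T + r + 1) + r then
    ⟨j - (T + (2 * T + r + 1)), by omega⟩ else Fin.last r

theorem starFreeBit_add (r T : ℕ) {i : ℕ} (hi : i < r) :
    starFreeBit r T (T + (2 * T + r + 1) + i) = ⟨i, by omega⟩ := by
  rw [starFreeBit, dif_pos (by omega)]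
  exact Fin.ext (by simp)

theorem starFreeBit_of_lt {r T j : ℕ} (hj : j < T + (2 * T + r + 1)) :
    starFreeBit r T j = Fin.last r := by
  rw [starFreeBit, dif_neg (by omega)]

theorem starFreeBit_of_le {r T j : ℕ} (hj : T + (2 * T + r + 1) + r ≤ j) :
    starFreeBit r T j = Fin.last r := by
  rw [starFreeBit, dif_neg (by omega)]

theorem forall_ne_last_iff {r : ℕ} {x y : Fin (r + 1) → Bool} :
    (∀ l, l ≠ Fin.last r → x l = y l) ↔ ∀ l : Fin r, x l.castSucc = y l.castSucc := by
  constructor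
  · exact fun h l => h _ (Fin.castSucc_lt_last l).ne
  · intro h l hl
    obtain ⟨l, rfl⟩ := Fin.exists_castSucc_eq.2 hl
    exact h l

/-- An enumeration `e b t`, `t < L`, of the chain configurations of `M'` for each input `b`, where
`L = 3 T + r + 1`. -/
structure IsChainEnumeration (M : GeneralMachine S W K O) (input : (Fin r → Bool) → S) (T : ℕ)
    (e : (Fin r → Bool) → ℕ → M.ElongConfig (T + (2 * T + r + 1))) : Prop where
  path : ∀ b, (M.withHolding (r := r) T).IsMaximalPath (e b) (T + (2 * T + r + 1) - 1)
  zero : ∀ b, e b 0 = M.toElong _ (input b)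
  reversible : (M.withHolding (r := r) T).IsReversible
  injective : Function.Injective input

theorem Samples.exists_isChainEnumeration {𝒟 : PMF O} (hM : M.Samples input 𝒟)
    (hT : ∀ b, M.chainLength (input b) ≤ T) :
    ∃ g : (Fin r → Bool) → O, IsGenerator 𝒟 g ∧ ∃ e, M.IsChainEnumeration input T e ∧
      ∀ b t, T ≤ t → t < T + (2 * T + r + 1) → (M.withHolding (r := r) T).output (e b t) = g b := by
  obtain ⟨g, hg, hhalt⟩ := hM.computes
  have h1 : ∀ b, ∃ e : ℕ → M.ElongConfig (T + (2 * T + r + 1)),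
      (M.withHolding (r := r) T).IsMaximalPath e (T + (2 * T + r + 1) - 1) ∧
      e 0 = M.toElong _ (input b) ∧ ∀ t, T ≤ t → t < T + (2 * T + r + 1) →
        (M.withHolding (r := r) T).output (e t) = g b := by
    intro b
    obtain ⟨c, n, hc, hc0, hout⟩ := (hhalt b).exists_isMaximalPath (hM.input_initial b)
    have hn := hc.chainLength_eq hM.reversible
    have hTb := hT b
    rw [← hc0, hn] at hTb
    obtain ⟨e, he, he0, heo⟩ :=
      hc.exists_elongate hM.reversible (L := T + (2 * T + r + 1)) (by omega)
    refine ⟨e, he, by rw [he0, hc0], fun t ht htL => ?_⟩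
    rw [← hout]
    exact heo t (by omega) htL
  choose e he using h1
  exact ⟨g, hg, e, ⟨fun b => (he b).1, fun b => (he b).2.1, hM.reversible.elongate _,
    hM.input_injective⟩, fun b => (he b).2.2⟩

namespace IsChainEnumeration

variable {e : (Fin r → Bool) → ℕ → M.ElongConfig (T + (2 * T + r + 1))}

theorem eq_iff (he : M.IsChainEnumeration input T e) {b b' : Fin r → Bool} {t t' : ℕ}
    (ht : t < T + (2 * T + r + 1)) (ht' : t' < T + (2 * T + r + 1)) :
    e b t = e b' t' ↔ b = b' ∧ t = t' := by
  constructor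
  · intro h
    obtain ⟨h1, h2⟩ := (he.path b).eq_of_eq (he.path b') he.reversible
      (Nat.le_sub_one_of_lt ht) (Nat.le_sub_one_of_lt ht') h
    rw [he.zero, he.zero] at h1
    exact ⟨he.injective (congrArg (fun q => q.1.1) h1), h2⟩
  · rintro ⟨rfl, rfl⟩
    rfl

theorem next_iff (he : M.IsChainEnumeration input T e) {b b' : Fin r → Bool} {t t' : ℕ}
    (ht : t < T + (2 * T + r + 1)) (ht' : t' < T + (2 * T + r + 1)) :
    e b' t' ∈ (M.withHolding (r := r) T).next (e b t) ↔ b' = b ∧ t' = t + 1 := by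
  rw [(he.path b).mem_next_iff he.reversible (Nat.le_sub_one_of_lt ht)]
  constructor
  · rintro ⟨h1, h2⟩
    exact (he.eq_iff ht' (by omega)).1 h2
  · rintro ⟨rfl, rfl⟩
    exact ⟨by omega, rfl⟩

theorem reaches_iff (he : M.IsChainEnumeration input T e) (b : Fin r → Bool)
    (c : M.ElongConfig (T + (2 * T + r + 1))) :
    (M.withHolding (r := r) T).Reaches (M.toElong _ (input b)) c ↔
      ∃ t, t < T + (2 * T + r + 1) ∧ c = e b t := by
  rw [← he.zero b, (he.path b).reaches_iff he.reversible]
  have : ∀ t, t ≤ T + (2 * T + r + 1) - 1 ↔ t < T + (2 * T + r + 1) := fun t => by omega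
  simp only [this]

theorem position_eq (he : M.IsChainEnumeration input T e) (b : Fin r → Bool) {t : ℕ}
    (ht : t < T + (2 * T + r + 1)) : (M.withHolding (r := r) T).position (e b t) = t + 1 :=
  (he.path b).position_eq he.reversible (Nat.le_sub_one_of_lt ht)

/-- The chain configuration in position `t + 1` of the chain for `b`. -/
def config (he : M.IsChainEnumeration input T e) (b : Fin r → Bool) (t : ℕ) :
    M.ChainConfig input T :=
  if h : t < T + (2 * T + r + 1) then ⟨e b t, b, (he.reaches_iff b _).2 ⟨t, h, rfl⟩⟩
  else M.chainStart input T b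

theorem config_val (he : M.IsChainEnumeration input T e) (b : Fin r → Bool) {t : ℕ}
    (ht : t < T + (2 * T + r + 1)) : (he.config b t).1 = e b t := by
  rw [config, dif_pos ht]

theorem exists_config_eq (he : M.IsChainEnumeration input T e) (c : M.ChainConfig input T) :
    ∃ q : (Fin r → Bool) × ℕ, q.2 < T + (2 * T + r + 1) ∧ he.config q.1 q.2 = c := by
  obtain ⟨b, hb⟩ := c.2
  obtain ⟨t, ht, hc⟩ := (he.reaches_iff b _).1 hb
  exact ⟨(b, t), ht, Subtype.ext (by rw [he.config_val b ht, hc])⟩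

/-- The input and the time of a chain configuration. -/
noncomputable def coord (he : M.IsChainEnumeration input T e) (c : M.ChainConfig input T) :
    (Fin r → Bool) × ℕ := (he.exists_config_eq c).choose

theorem coord_snd_lt (he : M.IsChainEnumeration input T e) (c : M.ChainConfig input T) :
    (he.coord c).2 < T + (2 * T + r + 1) := (he.exists_config_eq c).choose_spec.1

theorem config_coord (he : M.IsChainEnumeration input T e) (c : M.ChainConfig input T) :
    he.config (he.coord c).1 (he.coord c).2 = c := (he.exists_config_eq c).choose_spec.2

theorem val_eq (he : M.IsChainEnumeration input T e) (c : M.ChainConfig input T) :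
    c.1 = e (he.coord c).1 (he.coord c).2 := by
  rw [← he.config_val _ (he.coord_snd_lt c), he.config_coord]

theorem coord_config (he : M.IsChainEnumeration input T e) (b : Fin r → Bool) {t : ℕ}
    (ht : t < T + (2 * T + r + 1)) : he.coord (he.config b t) = (b, t) := by
  have h := he.val_eq (he.config b t)
  rw [he.config_val b ht, he.eq_iff ht (he.coord_snd_lt _)] at h
  exact Prod.ext h.1.symm h.2.symm

theorem eq_chainStart_iff (he : M.IsChainEnumeration input T e) (c : M.ChainConfig input T)
    (b : Fin r → Bool) : c = M.chainStart input T b ↔ b = (he.coord c).1 ∧ (he.coord c).2 = 0 := by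
  rw [← Subtype.coe_inj, he.val_eq c]
  show _ = M.toElong _ (input b) ↔ _
  rw [← he.zero b, he.eq_iff (he.coord_snd_lt c) (by omega)]
  exact and_congr_left fun _ => eq_comm

theorem mem_next_iff (he : M.IsChainEnumeration input T e) (c d : M.ChainConfig input T) :
    d.1 ∈ (M.withHolding (r := r) T).next c.1 ↔
      (he.coord d).1 = (he.coord c).1 ∧ (he.coord d).2 = (he.coord c).2 + 1 := by
  rw [he.val_eq c, he.val_eq d, he.next_iff (he.coord_snd_lt c) (he.coord_snd_lt d)]

/-- The level of a configuration of `M*`, counted from left to right. -/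
noncomputable def level (he : M.IsChainEnumeration input T e) : M.StarConfig input T → ℕ
  | .inl (i, _) => T + (2 * T + r + 1) + i
  | .inr (false, _, c) => T + (2 * T + r + 1) - 1 - (he.coord c).2
  | .inr (true, _, c) => T + (2 * T + r + 1) + r + 1 + (he.coord c).2

/-- The bitstring of a configuration of `M*`; the last bit of a chain configuration names the
copy. -/
noncomputable def bits (he : M.IsChainEnumeration input T e) :
    M.StarConfig input T → Fin (r + 1) → Bool
  | .inl (_, x) => x
  | .inr (_, copy, c) => Fin.snoc (α := fun _ => Bool) (he.coord c).1 copy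

/-- The configuration of `M*` with the given level and bitstring. -/
def node (he : M.IsChainEnumeration input T e) (j : ℕ) (x : Fin (r + 1) → Bool) :
    M.StarConfig input T :=
  if j < T + (2 * T + r + 1) then
    .inr (false, x (Fin.last r), he.config (fun l => x l.castSucc) (T + (2 * T + r + 1) - 1 - j))
  else if h : j < T + (2 * T + r + 1) + r + 1 then
    .inl (⟨j - (T + (2 * T + r + 1)), by omega⟩, x)
  else .inr (true, x (Fin.last r),
    he.config (fun l => x l.castSucc) (j - (T + (2 * T + r + 1) + r + 1)))

/-- Doubling the chains and joining the two copies crosswise turns every chain edge and every link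
to the randomizer into an edge whose free bit is the last one, so all edges follow one pattern. -/
theorem starStep_iff (he : M.IsChainEnumeration input T e) (U V : M.StarConfig input T) :
    M.starStep input T U V ↔ he.level V = he.level U + 1 ∧
      ∀ l, l ≠ starFreeBit r T (he.level U) → he.bits U l = he.bits V l := by
  rcases U with ⟨i, x⟩ | ⟨_ | _, k, c⟩ <;> rcases V with ⟨j, y⟩ | ⟨_ | _, k', d⟩
  · have hi := i.2
    have hj := j.2
    simp only [starStep, level, bits]
    constructor
    · rintro ⟨h1, h2⟩
      refine ⟨by omega, ?_⟩
      rwa [starFreeBit_add r T (by omega : (i : ℕ) < r)]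
    · rintro ⟨h1, h2⟩
      rw [starFreeBit_add r T (by omega : (i : ℕ) < r)] at h2
      exact ⟨by omega, h2⟩
  · simp only [starStep, level, bits, false_iff, not_and]
    intro h
    omega
  · have hi := i.2
    simp only [starStep, level, bits, he.eq_chainStart_iff]
    constructor
    · rintro ⟨rfl, h1, h2⟩
      refine ⟨by simp [h2], ?_⟩
      rw [starFreeBit_of_le (by simp), forall_ne_last_iff]
      intro l
      rw [Fin.snoc_castSucc, ← h1]
    · rintro ⟨h1, h2⟩
      have hir : (i : ℕ) = r := by omega
      rw [starFreeBit_of_le (by omega), forall_ne_last_iff] at h2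
      refine ⟨Fin.ext hir, ?_, by omega⟩
      ext l
      rw [h2 l, Fin.snoc_castSucc]
  · have hc := he.coord_snd_lt c
    have hj := j.2
    simp only [starStep, level, bits, he.eq_chainStart_iff]
    constructor
    · rintro ⟨rfl, h1, h2⟩
      refine ⟨by simp only [h2, Fin.val_zero]; omega, ?_⟩
      rw [starFreeBit_of_lt (by omega), forall_ne_last_iff]
      intro l
      rw [Fin.snoc_castSucc, ← h1]
    · rintro ⟨h1, h2⟩
      rw [starFreeBit_of_lt (by omega), forall_ne_last_iff] at h2
      refine ⟨Fin.ext (by simp only [Fin.val_zero]; omega), ?_, by omega⟩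
      ext l
      rw [← h2 l, Fin.snoc_castSucc]
  · have hc := he.coord_snd_lt c
    have hd := he.coord_snd_lt d
    simp only [starStep, level, bits, he.mem_next_iff]
    rw [starFreeBit_of_lt (by omega), forall_ne_last_iff]
    simp only [Fin.snoc_castSucc]
    rw [← funext_iff, and_comm]
    exact and_congr (by omega) Iff.rfl
  · simp only [starStep, level, bits, false_iff, not_and]
    intro h
    omega
  · have hj := j.2
    simp only [starStep, level, bits, false_iff, not_and]
    intro h
    omega
  · simp only [starStep, level, bits, false_iff, not_and]
    intro h
    omega
  · simp only [starStep, level, bits, he.mem_next_iff]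
    rw [starFreeBit_of_le (by omega), forall_ne_last_iff]
    simp only [Fin.snoc_castSucc]
    rw [← funext_iff, and_comm]
    exact and_congr (by omega) eq_comm

/-- The configurations of `M*` form a layered cube. -/
noncomputable def layeredCube (he : M.IsChainEnumeration input T e) :
    LayeredCube (r + 1) (3 * (2 * T + r + 1)) (M.starStep input T) where
  level := he.level
  bits := he.bits
  node := he.node
  freeBit := starFreeBit r T
  level_lt U := by
    rcases U with ⟨i, x⟩ | ⟨_ | _, k, c⟩
    · have := i.2
      simp only [level]
      omega
    · simp only [level]
      omega
    · have := he.coord_snd_lt c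
      simp only [level]
      omega
  node_level_bits U := by
    rcases U with ⟨i, x⟩ | ⟨_ | _, k, c⟩
    · have := i.2
      rw [node, if_neg (by simp [level]), dif_pos (by simp only [level]; omega)]
      simp [level, bits]
    · have := he.coord_snd_lt c
      rw [node, if_pos (by simp only [level]; omega)]
      have h1 : T + (2 * T + r + 1) - 1 - he.level (.inr (false, k, c)) = (he.coord c).2 := by
        simp only [level]
        omega
      rw [h1]
      simp only [bits, Fin.snoc_castSucc, Fin.snoc_last]
      rw [he.config_coord]
    · rw [node, if_neg (by simp only [level]; omega), dif_neg (by simp only [level]; omega)]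
      have h1 : he.level (.inr (true, k, c)) - (T + (2 * T + r + 1) + r + 1) =
          (he.coord c).2 := by
        simp only [level]
        omega
      rw [h1]
      simp only [bits, Fin.snoc_castSucc, Fin.snoc_last]
      rw [he.config_coord]
  level_node j hj x := by
    rw [node]
    split_ifs with h1 h2
    · rw [level, he.coord_config _ (by omega)]
      simp only
      omega
    · simp only [level]
      omega
    · rw [level, he.coord_config _ (by omega)]
      simp only
      omega
  bits_node j hj x := by
    rw [node]
    split_ifs with h1 h2
    · rw [bits, he.coord_config _ (by omega)]
      exact Fin.snoc_init_self x
    · rfl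
    · rw [bits, he.coord_config _ (by omega)]
      exact Fin.snoc_init_self x
  step_iff := he.starStep_iff

/-- This explains the number of holding configurations: the first T configurations of the chains on
each side, together with the r + 1 columns, make up 2T + r + 1 levels, exactly as many as hold
nonzero metadata on either side. -/
theorem starMetadata_eq (he : M.IsChainEnumeration input T e) (U : M.StarConfig input T) :
    M.starMetadata input T U = if he.level U < 2 * T + r + 1 then -1 else
      if 2 * (2 * T + r + 1) ≤ he.level U then 1 else 0 := by
  rcases U with ⟨i, x⟩ | ⟨_ | _, k, c⟩
  · have := i.2
    rw [level, if_neg (by omega), if_neg (by omega), starMetadata]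
  · have hc := he.coord_snd_lt c
    rw [starMetadata, he.val_eq c, he.position_eq _ hc, level]
    by_cases h : T < (he.coord c).2 + 1
    · rw [if_pos h, if_neg Bool.false_ne_true, if_pos (by omega)]
    · rw [if_neg h, if_neg (by omega), if_neg (by omega)]
  · have hc := he.coord_snd_lt c
    rw [starMetadata, he.val_eq c, he.position_eq _ hc, level]
    by_cases h : T < (he.coord c).2 + 1
    · rw [if_pos h, if_pos rfl, if_neg (by omega), if_pos (by omega)]
    · rw [if_neg h, if_neg (by omega), if_neg (by omega)]

theorem output_eq (he : M.IsChainEnumeration input T e) {g : (Fin r → Bool) → O}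
    (hg : ∀ b t, T ≤ t → t < T + (2 * T + r + 1) →
      (M.withHolding (r := r) T).output (e b t) = g b) (blank : O) {U : M.StarConfig input T}
    (hU : M.starMetadata input T U ≠ 0) :
    (M.lasVegas input T blank).output U = g fun l => he.bits U l.castSucc := by
  rcases U with ⟨i, x⟩ | ⟨s, k, c⟩
  · exact absurd rfl hU
  · have hc := he.coord_snd_lt c
    rw [starMetadata, he.val_eq c, he.position_eq _ hc] at hU
    have h : T < (he.coord c).2 + 1 := by
      by_contra h
      exact hU (if_neg h)
    show (M.withHolding (r := r) T).output c.1 = _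
    rw [he.val_eq c, hg _ _ (by omega) hc]
    congr 1
    ext l
    rw [bits, Fin.snoc_castSucc]

end IsChainEnumeration

end Star

end GeneralMachine

/-! ### The target law as a proportion of bitstrings, and the fresh bits at each level. -/

theorem SignType.eq_one_or_neg_one {s : SignType} (hs : s ≠ 0) : s = 1 ∨ s = -1 := by
  revert s
  decide

/-- The proportion of the bitstrings that `g` maps to `B`. -/
noncomputable def bitProportion {O : Type*} {r : ℕ} (g : (Fin r → Bool) → O) (B : Set O) : ℝ≥0 :=
  (g ⁻¹' B).ncard / 2 ^ r

theorem IsGenerator.toMeasure_eq {O : Type*} {r : ℕ} {𝒟 : PMF O} {g : (Fin r → Bool) → O}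
    (hg : IsGenerator 𝒟 g) (B : Set O) : @PMF.toMeasure O ⊤ 𝒟 B = bitProportion g B := by
  classical
  let _ : MeasurableSpace O := ⊤
  let _ : MeasurableSpace (Fin r → Bool) := ⊤
  rw [IsGenerator] at hg
  rw [← hg, PMF.toMeasure_map_apply _ _ _ measurable_from_top MeasurableSpace.measurableSet_top,
    PMF.toMeasure_uniformOfFintype_apply _ MeasurableSpace.measurableSet_top]
  rw [bitProportion, ENNReal.coe_div (by positivity), Set.ncard_eq_toFinset_card',
    Set.toFinset_card]
  simp

theorem sum_comp_castSucc {r : ℕ} (f : (Fin r → Bool) → ℝ) :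
    ∑ x : Fin (r + 1) → Bool, f (fun l => x l.castSucc) = 2 * ∑ b, f b := by
  rw [← Equiv.sum_comp (Fin.snocEquiv fun _ : Fin (r + 1) => Bool), Fintype.sum_prod_type]
  simp [Fin.snocEquiv, two_mul]

theorem sum_indicator_sub_bitProportion {O : Type*} {r : ℕ} (g : (Fin r → Bool) → O) (B : Set O) :
    ∑ b, (B.indicator (fun _ => (1 : ℝ)) (g b) - bitProportion g B) = 0 := by
  classical
  have h : ∑ b, B.indicator (fun _ => (1 : ℝ)) (g b) = (g ⁻¹' B).ncard := by
    simp only [Set.indicator_apply]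
    rw [Finset.sum_boole, Set.ncard_eq_toFinset_card']
    congr 2
    ext b
    simp
  rw [Finset.sum_sub_distrib, h, bitProportion]
  simp only [Finset.sum_const, Finset.card_univ, Fintype.card_fun, Fintype.card_bool,
    Fintype.card_fin, nsmul_eq_mul]
  push_cast
  field_simp
  ring

namespace GeneralMachine

/-- The bits which have been randomized when the walk, coming from the side opposite to `s`, is at
level `j`. -/
def starFreshBits (r T : ℕ) (s : SignType) (j : ℕ) : Set (Fin (r + 1)) :=
  {l | ∃ i, T + (2 * T + r + 1) ≤ i ∧ i < T + (2 * T + r + 1) + r ∧ starFreeBit r T i = l ∧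
    if s = 1 then i < j else j ≤ i}

theorem mem_starFreshBits_succ_iff {r T : ℕ} (s : SignType) (j : ℕ) {l : Fin (r + 1)}
    (hl : l ≠ starFreeBit r T j) :
    l ∈ starFreshBits r T s j ↔ l ∈ starFreshBits r T s (j + 1) := by
  have : ∀ i, starFreeBit r T i = l →
      ((if s = 1 then i < j else j ≤ i) ↔ if s = 1 then i < j + 1 else j + 1 ≤ i) := by
    intro i hi
    have hij : i ≠ j := by
      rintro rfl
      exact hl hi.symm
    split_ifs <;> omega
  constructor
  · rintro ⟨i, h1, h2, h3, h4⟩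
    exact ⟨i, h1, h2, h3, (this i h3).1 h4⟩
  · rintro ⟨i, h1, h2, h3, h4⟩
    exact ⟨i, h1, h2, h3, (this i h3).2 h4⟩

/-- The value of the metadata register of `M*` at the level `j`. -/
def levelMetadata (H j : ℕ) : SignType :=
  if j < H then -1 else if 2 * H ≤ j then 1 else 0

theorem levelMetadata_eq_one_iff {H j : ℕ} : levelMetadata H j = 1 ↔ 2 * H ≤ j := by
  rw [levelMetadata]
  split_ifs with h1 h2
  · exact iff_of_false (by decide) (by omega)
  · exact iff_of_true rfl (by omega)
  · exact iff_of_false (by decide) (by omega)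

theorem levelMetadata_eq_neg_one_iff {H j : ℕ} : levelMetadata H j = -1 ↔ j < H := by
  rw [levelMetadata]
  split_ifs with h1 h2
  · exact iff_of_true rfl h1
  · exact iff_of_false (by decide) h1
  · exact iff_of_false (by decide) h1

theorem starFreshBits_eq_empty {r T j : ℕ} {s : SignType} (hs : s ≠ 0)
    (h : levelMetadata (2 * T + r + 1) j = -s) : starFreshBits r T s j = ∅ := by
  refine Set.eq_empty_of_forall_notMem ?_
  rintro l ⟨i, h1, h2, -, h4⟩
  have hs' := SignType.eq_one_or_neg_one hs
  rcases hs' with rfl | rfl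
  · rw [levelMetadata_eq_neg_one_iff] at h
    rw [if_pos rfl] at h4
    omega
  · rw [neg_neg, levelMetadata_eq_one_iff] at h
    rw [if_neg (by decide)] at h4
    omega

theorem castSucc_mem_starFreshBits {r T j : ℕ} {s : SignType} (hs : s ≠ 0)
    (h : levelMetadata (2 * T + r + 1) j = s) (l : Fin r) :
    l.castSucc ∈ starFreshBits r T s j := by
  have hl := l.2
  refine ⟨T + (2 * T + r + 1) + l, by omega, by omega, starFreeBit_add r T l.2, ?_⟩
  have hs' := SignType.eq_one_or_neg_one hs
  rcases hs' with rfl | rfl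
  · rw [levelMetadata_eq_one_iff] at h
    rw [if_pos rfl]
    omega
  · rw [levelMetadata_eq_neg_one_iff] at h
    rw [if_neg (by decide)]
    omega

end GeneralMachine

/-! ### Efficiency and sampling for adiabatic embeddings. -/

namespace PhysicalEmbedding

open GeneralMachine

variable {S W O : Type*} {M : GeneralMachine S W SignType O} {P : PhysicalEmbedding M}

theorem indicator_metadata_eq_one {H : ℕ} {lev : S → ℕ}
    (hmeta : ∀ U, M.metadata U = levelMetadata H (lev U)) :
    {C | M.metadata C = 1}.indicator (fun _ => (1 : ℝ)) =
      fun V => if 2 * H ≤ lev V then 1 else 0 := by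
  classical
  ext V
  have h : V ∈ {C | M.metadata C = 1} ↔ 2 * H ≤ lev V := by
    rw [Set.mem_ofPred_eq, hmeta, levelMetadata_eq_one_iff]
  rw [Set.indicator_apply]
  exact if_congr h rfl rfl

variable [Finite S]

theorem probIn_eq_mulVec (P : PhysicalEmbedding M) (t : ℝ) (U : S) (A : Set S) :
    letI := Fintype.ofFinite S
    P.probIn t U A = (P.transition t *ᵥ A.indicator fun _ => 1) U := by
  let _ := Fintype.ofFinite S
  refine Finset.sum_congr rfl fun V _ => ?_
  by_cases hV : V ∈ A
  · rw [Set.indicator_of_mem hV, Set.indicator_of_mem hV, mul_one]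
  · rw [Set.indicator_of_notMem hV, Set.indicator_of_notMem hV, mul_zero]

variable {n H : ℕ}

theorem IsAdiabatic.isWalkGenerator_of_layeredCube (hP : P.IsAdiabatic)
    (G : LayeredCube n H fun U V => V ∈ M.next U) :
    letI := Fintype.ofFinite S
    P.generator.IsWalkGenerator P.k fun U V => V ∈ M.next U :=
  hP.isWalkGenerator fun U V h1 h2 => by
    have h3 := ((G.step_iff U V).1 h1).1
    have h4 := ((G.step_iff V U).1 h2).1
    omega

theorem IsAdiabatic.transition_nonneg (hP : P.IsAdiabatic)
    (G : LayeredCube n H fun U V => V ∈ M.next U) (t : ℝ) (ht : 0 ≤ t) (U V : S) :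
    0 ≤ P.transition t U V := by
  classical
  let _ := Fintype.ofFinite S
  have h := exp_smul_mulVec_nonneg (hP.isWalkGenerator_of_layeredCube G).1 ht
    (f := Pi.single V 1) (fun W => by
      rw [Pi.single_apply]
      split_ifs
      exacts [zero_le_one, le_rfl]) U
  rw [Matrix.mulVec_single_one] at h
  exact h

theorem IsAdiabatic.quarter_le_probIn (hP : P.IsAdiabatic)
    (G : LayeredCube n (3 * H) fun U V => V ∈ M.next U) (hH : 0 < H)
    (hmeta : ∀ U, M.metadata U = levelMetadata H (G.level U)) {t : ℝ}
    (ht : 12 * ((3 * H : ℕ) : ℝ) ^ 2 / (2 * P.k) ≤ t) {s : SignType} (hs : s ≠ 0) (U : S) :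
    1 / 4 ≤ P.probIn t U {C | M.metadata C = s} := by
  classical
  let _ := Fintype.ofFinite S
  have hA := hP.isWalkGenerator_of_layeredCube G
  have hk : 0 < 2 * P.k := by linarith [P.k_pos]
  have hL := G.lumpsToPath hA
  have hs' := SignType.eq_one_or_neg_one hs
  rw [probIn_eq_mulVec]
  rcases hs' with rfl | rfl
  · rw [indicator_metadata_eq_one hmeta]
    exact hL.quarter_le_upper_third hk hA.1 hH ht U
  · have hind : {C | M.metadata C = -1}.indicator (fun _ => (1 : ℝ)) =
        fun V => if 2 * H ≤ 3 * H - 1 - G.level V then 1 else 0 := by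
      ext V
      have hV := G.level_lt V
      have h : V ∈ {C | M.metadata C = -1} ↔ 2 * H ≤ 3 * H - 1 - G.level V := by
        rw [Set.mem_ofPred_eq, hmeta, levelMetadata_eq_neg_one_iff]
        omega
      rw [Set.indicator_apply]
      exact if_congr h rfl rfl
    rw [hind]
    exact hL.reflect.quarter_le_upper_third hk hA.1 hH ht U

theorem IsAdiabatic.le_of_isEfficient (hP : P.IsAdiabatic)
    (G : LayeredCube n (3 * H) fun U V => V ∈ M.next U) (hH : 0 < H)
    (hmeta : ∀ U, M.metadata U = levelMetadata H (G.level U)) {t : ℝ} (ht : 0 ≤ t)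
    (he : P.IsEfficient t (3 / 4)) : (H : ℝ) ^ 2 / (2 * (2 * P.k)) ≤ t := by
  classical
  let _ := Fintype.ofFinite S
  have hA := hP.isWalkGenerator_of_layeredCube G
  have hk : 0 < 2 * P.k := by linarith [P.k_pos]
  have hL := G.lumpsToPath hA
  obtain ⟨U, hU⟩ := hL.surj 0 (by omega)
  refine hL.le_of_quarter_le_upper_third hk hA.1 ht hU ?_
  have h := (he U).2
  rw [probIn_eq_mulVec, indicator_metadata_eq_one hmeta] at h
  exact le_trans (by norm_num) h

variable {r T : ℕ}

theorem IsAdiabatic.isFreshSampler (hP : P.IsAdiabatic)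
    (G : LayeredCube (r + 1) (3 * (2 * T + r + 1)) fun U V => V ∈ M.next U)
    (hfree : G.freeBit = starFreeBit r T)
    (hmeta : ∀ U, M.metadata U = levelMetadata (2 * T + r + 1) (G.level U))
    {g : (Fin r → Bool) → O}
    (hout : ∀ U, M.metadata U ≠ 0 → M.output U = g fun l => G.bits U l.castSucc)
    {t : ℝ} (ht : 0 ≤ t) :
    letI := Fintype.ofFinite S
    IsFreshSampler (P.transition t) M.metadata M.output (bitProportion g)
      fun s => G.centered (starFreshBits r T s) := by
  classical
  let _ := Fintype.ofFinite S
  have hA := hP.isWalkGenerator_of_layeredCube G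
  refine ⟨?_, ?_, ?_, ?_⟩
  · intro s _ f hf
    refine LayeredCube.exp_mulVec_mem_centered hA (fun j l hl => ?_) hf ht
    rw [hfree] at hl
    exact mem_starFreshBits_succ_iff s j hl
  · intro s _ f hf
    -- The metadata is a function of the level, so stopping is multiplication by a function of the
    -- level.
    have h := LayeredCube.mul_level_mem_centered hf
      fun j => if levelMetadata (2 * T + r + 1) j = s then 0 else 1
    convert h using 2 with U
    rw [hmeta]
    split_ifs <;> simp
  · intro s hs f hf U hU
    refine LayeredCube.eq_zero_of_mem_centered hf (starFreshBits_eq_empty hs ?_)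
    rw [← hmeta, hU]
  · intro s hs B j hj
    have hval : ∀ x, (if M.metadata (G.node j x) = s then
        (M.output ⁻¹' B).indicator (fun _ => (1 : ℝ)) (G.node j x) - bitProportion g B else 0) =
        if levelMetadata (2 * T + r + 1) j = s then
          B.indicator (fun _ => (1 : ℝ)) (g fun l => x l.castSucc) - bitProportion g B else 0 := by
      intro x
      have hm := hmeta (G.node j x)
      rw [G.level_node j hj] at hm
      rw [hm]
      split_ifs with h
      · have ho := hout (G.node j x) (by rwa [hm, h])
        rw [G.bits_node j hj] at ho
        rw [← ho]
        rfl
      · rfl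
    simp only [hval]
    split_ifs with h
    -- The output depends only on the first r bits, all of which are fresh on side `s`, and
    -- subtracting `bitProportion` makes the level sum zero.
    · refine ⟨fun x y hxy => ?_, ?_⟩
      · have : (fun l : Fin r => x l.castSucc) = fun l => y l.castSucc :=
          funext fun l => hxy _ (castSucc_mem_starFreshBits hs h l)
        rw [this]
      · rw [sum_comp_castSucc fun b => B.indicator (fun _ => (1 : ℝ)) (g b) - bitProportion g B,
          sum_indicator_sub_bitProportion, mul_zero]
    · exact ⟨fun _ _ _ => rfl, Finset.sum_const_zero⟩

theorem IsAdiabatic.isLasVegasSampler (hP : P.IsAdiabatic)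
    (G : LayeredCube (r + 1) (3 * (2 * T + r + 1)) fun U V => V ∈ M.next U)
    (hfree : G.freeBit = starFreeBit r T)
    (hmeta : ∀ U, M.metadata U = levelMetadata (2 * T + r + 1) (G.level U))
    {g : (Fin r → Bool) → O} {𝒟 : PMF O} (hg : IsGenerator 𝒟 g)
    (hout : ∀ U, M.metadata U ≠ 0 → M.output U = g fun l => G.bits U l.castSucc) :
    P.IsLasVegasSampler 𝒟 := by
  classical
  let _ := Fintype.ofFinite S
  let _ : MeasurableSpace O := ⊤
  intro Ω _ μ _ C₀ X hX τ hτ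
  have hY := hX.isMarkovChain (hP.transition_nonneg G) τ
  set Y : ℕ → Ω → S := fun n ω => X ((n + 1) * τ) ω with hYdef
  have hF := hP.isFreshSampler G hfree hmeta hout (t := τ) τ.2
  -- `K` measurement steps together exceed the mixing time, however small `τ` is.
  obtain ⟨K, hK⟩ := exists_nat_ge
    (12 * ((3 * (2 * T + r + 1) : ℕ) : ℝ) ^ 2 / (2 * P.k) / (τ : ℝ))
  have hτ' : (0 : ℝ) < τ := hτ
  rw [div_le_iff₀ hτ'] at hK
  have hpow : P.transition τ ^ K = P.transition (K * τ) := by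
    rw [transition, transition, ← Matrix.exp_nsmul, ← Nat.cast_smul_eq_nsmul ℝ, smul_smul]
  have hio : ∀ s : SignType, s ≠ 0 → ∀ᵐ ω ∂μ, ∀ n, ∃ m ≥ n, metaSeq M.metadata Y ω m = s := by
    intro s hs
    refine hY.ae_frequently_mem (A := {C | M.metadata C = s}) (K := K) fun U => ?_
    rw [hpow, ← probIn_eq_mulVec]
    exact hP.quarter_le_probIn G (by omega) hmeta hK hs U
  have hinf : ∀ᵐ ω ∂μ, {n | Accepts (metaSeq M.metadata Y ω) n}.Infinite := by
    filter_upwards [hio 1 (by decide), hio (-1) (by decide)] with ω h1 h2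
    exact infinite_accepts h1 h2
  obtain ⟨hind, hlaw⟩ := hF.iIndepFun_outputSeq hY hinf
  refine ⟨hinf, hind, fun j => ?_⟩
  refine Measure.ext fun B hB => ?_
  rw [hg.toMeasure_eq, ← hlaw j B]
  exact Measure.map_apply (hY.measurable_outputSeq j) hB

end PhysicalEmbedding

/-! ### The main theorem. -/

theorem mainTheorem1 :
    ∃ c₁ c₂ : ℝ, 0 < c₁ ∧ 0 < c₂ ∧
      ∀ (S W K O : Type*) [Finite S] (M : GeneralMachine S W K O) (r T : ℕ)
        (input : (Fin r → Bool) → S) (𝒟 : PMF O),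
        M.Samples input 𝒟 → (∀ b, M.chainLength (input b) ≤ T) →
        ∀ (blank : O) (P : PhysicalEmbedding (M.lasVegas input T blank)), P.IsAdiabatic →
          P.IsLasVegasSampler 𝒟 ∧
          (∀ τ : ℝ, c₂ * ((T : ℝ) ^ 2 + (r : ℝ) ^ 2) / P.k ≤ τ → P.IsEfficient τ (3 / 4)) ∧
          (∀ τ : ℝ, 0 ≤ τ → P.IsEfficient τ (3 / 4) →
            c₁ * ((T : ℝ) ^ 2 + (r : ℝ) ^ 2) / P.k ≤ τ) := by
  -- With H = 2T + r + 1, the sufficient time is 12 (3H)^2 / (2k) = 54 H^2 / k, and H^2 ≤ 18 (T^2 +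
  -- r^2) gives 54 · 18 = 972. The necessary time is H^2 / (4k), and H^2 ≥ T^2 + r^2.
  refine ⟨1 / 4, 972, by norm_num, by norm_num, ?_⟩
  intro S W K O _ M r T input 𝒟 hM hT blank P hP
  obtain ⟨g, hg, e, he, heo⟩ := hM.exists_isChainEnumeration hT
  have hG : ∃ G : LayeredCube (r + 1) (3 * (2 * T + r + 1))
      (fun U V => V ∈ (M.lasVegas input T blank).next U),
      G.freeBit = GeneralMachine.starFreeBit r T ∧ (∀ U, (M.lasVegas input T blank).metadata U =
        GeneralMachine.levelMetadata (2 * T + r + 1) (G.level U)) ∧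
      ∀ U, (M.lasVegas input T blank).metadata U ≠ 0 →
        (M.lasVegas input T blank).output U = g fun l => G.bits U l.castSucc :=
    ⟨he.layeredCube, rfl, he.starMetadata_eq, fun U hU => he.output_eq heo blank hU⟩
  obtain ⟨G, hfree, hmeta, hout⟩ := hG
  have hk := P.k_pos
  -- A chain contains its own start; this absorbs the 1 in H into T.
  have hT1 : 1 ≤ T := by
    refine le_trans ?_ (hT fun _ => false)
    exact (Set.ncard_pos (Set.toFinite _)).2 ⟨_, Relation.ReflTransGen.refl⟩
  have hT1' : (1 : ℝ) ≤ T := by exact_mod_cast hT1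
  have hr : (0 : ℝ) ≤ r := r.cast_nonneg
  refine ⟨hP.isLasVegasSampler G hfree hmeta hg hout, fun τ hτ => ?_, fun τ hτ heff => ?_⟩
  · have hbound : 12 * ((3 * (2 * T + r + 1) : ℕ) : ℝ) ^ 2 / (2 * P.k) ≤ τ := by
      refine le_trans ?_ hτ
      rw [div_le_div_iff₀ (by positivity) hk]
      push_cast
      have h1 : (2 * (T : ℝ) + r + 1) ^ 2 ≤ (3 * T + r) ^ 2 :=
        pow_le_pow_left₀ (by positivity) (by linarith) 2
      have h2 : (3 * (T : ℝ) + r) ^ 2 ≤ 18 * (T ^ 2 + r ^ 2) := by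
        nlinarith [sq_nonneg (3 * (T : ℝ) - r), sq_nonneg (r : ℝ)]
      nlinarith [mul_le_mul_of_nonneg_right (h1.trans h2) hk.le]
    intro U
    have h34 : (1 : ℝ) - 3 / 4 = 1 / 4 := by norm_num
    rw [h34]
    exact ⟨hP.quarter_le_probIn G (by omega) hmeta hbound (by decide) U,
      hP.quarter_le_probIn G (by omega) hmeta hbound (by decide) U⟩
  · refine le_trans ?_ (hP.le_of_isEfficient G (by omega) hmeta hτ heff)
    rw [div_le_div_iff₀ hk (by positivity)]
    push_cast
    have h1 : (T : ℝ) ^ 2 + r ^ 2 ≤ (2 * T + r + 1) ^ 2 := by nlinarith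
    nlinarith [mul_le_mul_of_nonneg_right h1 hk.le]
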